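/- **Setting.** Let $K$ be an algebraically closed field, $\Gamma$ a finite quiver with vertices $e_1,\dots,e_n$, $I\subseteq K\Gamma$ an admissible ideal (all paths of some length lie in $I$, and $I$ is contained in the span of the paths of length $\ge 2$), $\Lambda=K\Gamma/I$, $J$ the Jacobson radical of $\Lambda$, and $L+1$ its nilpotency index. Products of paths are read from right to left ($pq$ is "first $q$, then $p$"), and modules are left modules. Put $S_i=\Lambda e_i/Je_i$. Fix a dimension vector $\mathbf d=(d_1,\dots,d_n)$ and let $d=\sum_i d_i$. Let $\mathbf P=\bigoplus_{1\le r\le d}\Lambda z_r$ be the projective cover of $\bigoplus_i S_i^{d_i}$, where $z_r=e(r)z_r$, $e(r)\in\{e_1,\dots,e_n\}$, $\Lambda z_r\cong\Lambda e(r)$, and each $e_i$ occurs exactly $d_i$ times among the $e(r)$; let $\widehat{\mathbf P}=\bigoplus_{r}K\Gamma\,\widehat z_r$ be the corresponding projective $K\Gamma$-module. A path in $\widehat{\mathbf P}$ is an element $p\widehat z_r$ with $p$ a path of $\Gamma$ starting in $e(r)$; its length and end vertex are those of $p$, and its initial subpaths are the $p_1\widehat z_r$ with $p=p_2p_1$.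 A *skeleton* $\sigma\subseteq\widehat{\mathbf P}$ with dimension vector $\mathbf d$ is a set of paths of length $\le L$, closed under initial subpaths, of which exactly $d_i$ end in $e_i$ for each $i$. Its top is $T=\bigoplus_{\widehat z_r\in\sigma}S(r)$, where $S(r)=\Lambda e(r)/Je(r)$. Let $\sigma_l$ be the set of paths of length $l$ in $\sigma$. For elements $x_r$ ($\widehat z_r\in\sigma$) of a $\Lambda$-module $M$, $\sigma$ is a skeleton of $M$ *relative to* $(x_r)$ if $x_r=e(r)x_r\notin JM$, the $x_r$ generate $M$ and are linearly independent modulo $JM$, and for $0\le l\le L$ the elements $px_r$ with $p\widehat z_r\in\sigma_l$ induce a $K$-basis of $J^lM/J^{l+1}M$; $\sigma$ is a skeleton of $M$ if this holds for some such $(x_r)$. If $M$ is a quotient of $\mathbf P$ (or of $P$ below), it is a *distinguished* skeleton of $M$ if this holds for the residue classes of the $z_r$ with $\widehat z_r\in\sigma$. Let $\mathrm{GRASS}(\sigma)$ be the set of the submodules $C\subseteq\mathbf P$ of dimension $\dim\mathbf P-d$ such that $\mathbf P/C$ has dimension vector $\mathbf d$ and $\sigma$ is a distinguished skeleton of $\mathbf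 P/C$. Let $P=\bigoplus_{\widehat z_r\in\sigma}\Lambda z_r$, the projective cover of $T$, and let $\mathrm{Grass}(\sigma)$ be the set of the submodules $C\subseteq JP$ of dimension $\dim P-d$ such that $\sigma$ is a distinguished skeleton of $P/C$. Both sets carry the structure induced by the Grassmannians of subspaces of $\mathbf P$ and $P$. A path in $\widehat{\mathbf P}\setminus\sigma$ of length $\le L$ is *$\sigma$-critical* if all its proper initial subpaths are in $\sigma$. The $\sigma$-set $\sigma(u\widehat z_r)$ of a $\sigma$-critical path $u\widehat z_r$ consists of the paths in $\sigma$ which are at least as long as $u\widehat z_r$ and end in the same vertex. Let $N$ be the set of all pairs $(u\widehat z_r,q\widehat z_s)$ with $u\widehat z_r$ $\sigma$-critical and $q\widehat z_s\in\sigma(u\widehat z_r)$, and $N_0\subseteq N$ the set of those pairs for which $u\widehat z_r$ has length $0$. For $c\in\mathbb A^N=K^N$ let $U(c)\subseteq\mathbf P$ be the $\Lambda$-submodule generated by the differences $uz_r-\sum_{q\widehat z_s\in\sigma(u\widehat z_r)}c_{u\widehat z_r,q\widehat z_s}\,qz_s$, where $u\widehat z_r$ runs through the $\sigma$-critical paths.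 **Theorem 3.17.** Let $\sigma\subseteq\widehat{\mathbf P}$ be a skeleton with top $T$ and dimension vector $\mathbf d$. (1) The variety $\mathrm{GRASS}(\sigma)$ is isomorphic to $\mathrm{Grass}(\sigma)\times\mathbb A^{N_0}$. Moreover, $\mathrm{GRASS}(\sigma)$ is an affine variety. (2) For each $C\in\mathrm{GRASS}(\sigma)$ there is exactly one point $c=\Psi(C)\in\mathbb A^N$ such that $$uz_r+C=\sum_{q\widehat z_s\in\sigma(u\widehat z_r)}c_{u\widehat z_r,q\widehat z_s}\,qz_s+C$$ in $\mathbf P/C$ for all $\sigma$-critical paths $u\widehat z_r$. The map $\Psi$ is an isomorphism from $\mathrm{GRASS}(\sigma)$ onto a closed subvariety of $\mathbb A^N$, and its inverse sends $c\in\operatorname{Im}\Psi$ to $U(c)$. If $\phi$ sends $C\in\mathrm{GRASS}(\sigma)$ to the isomorphism type of $\mathbf P/C$, and $\chi$ sends $c\in\operatorname{Im}\Psi$ to the isomorphism type of $\mathbf P/U(c)$, then $\phi$ and $\chi$ are maps to the set of isomorphism types of $\Lambda$-modules with skeleton $\sigma$, and $\chi=\phi\circ\Psi^{-1}$. (3)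 If $K_0$ is a subfield of $K$ such that $I$ has a set of generators, as a left ideal of $K\Gamma$, that lies in $K_0\Gamma$, then $\Psi(\mathrm{GRASS}(\sigma))$ is the zero locus in $\mathbb A^N$ of finitely many polynomials with coefficients in $K_0$. -/

import Mathlib

universe u v w z m

/-! ## Quasi-projective sets

A classical variety is presented here as a set of points inside a product `ℙ(K^A) × 𝔸^B` of a
projective and an affine space. Closed sets are the zero loci of polynomials which are homogeneous
in the `A`-variables, and regular functions are locally quotients of two such polynomials of the
same degree. -/

namespace QP

/-- A presentation of the set `X` as a set of points of `ℙ(K^A) × 𝔸^B`: each point has a vector of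
homogeneous coordinates (which matters only up to a common nonzero scalar) and a vector of affine
coordinates. With `A` empty this is a subset of the affine space `𝔸^B`, with `B` empty it is a
subset of the projective space `ℙ(K^A)`. -/
structure Coords (K : Type u) (X : Type*) (A B : Type*) where
  hom : X → A → K
  aff : X → B → K

variable {K : Type u} [Field K] {X Y A B A' B' M : Type*}

/-- `P` is a polynomial in the variables `A ⊕ B` that is homogeneous of degree `n` in the
`A`-variables. -/
def IsForm (P : MvPolynomial (A ⊕ B) K) (n : ℕ) : Prop :=
  P.IsWeightedHomogeneous (Sum.elim (fun _ => 1) (fun _ => 0) : A ⊕ B → ℕ) n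

namespace Coords

/-- The value of a polynomial at the coordinate vector of a point. -/
noncomputable def eval (s : Coords K X A B) (P : MvPolynomial (A ⊕ B) K) (x : X) : K :=
  MvPolynomial.eval (Sum.elim (s.hom x) (s.aff x)) P

/-- Zariski closed subsets: common zero loci of forms. -/
def IsClosed (s : Coords K X A B) (Z : Set X) : Prop :=
  ∃ S : Set (MvPolynomial (A ⊕ B) K), (∀ P ∈ S, ∃ n, IsForm P n) ∧
    Z = {x | ∀ P ∈ S, s.eval P x = 0}

/-- Zariski open subsets. -/
def IsOpen (s : Coords K X A B) (U : Set X) : Prop := s.IsClosed Uᶜ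

/-- `f` restricts to a regular function on the set `U`: near each point of `U` it is a quotient of
two forms of the same degree. -/
def IsRegularOn (s : Coords K X A B) (U : Set X) (f : X → K) : Prop :=
  ∀ x ∈ U, ∃ (n : ℕ) (P Q : MvPolynomial (A ⊕ B) K), IsForm P n ∧ IsForm Q n ∧ s.eval Q x ≠ 0 ∧
    ∀ y ∈ U, s.eval Q y ≠ 0 → f y = s.eval P y / s.eval Q y

/-- The presentation of a set that is mapped into `X`; for subsets of `X`, the induced structure. -/
def comap (s : Coords K X A B) (φ : Y → X) : Coords K Y A B where
  hom y := s.hom (φ y)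
  aff y := s.aff (φ y)

/-- The product of a subset of `ℙ(K^A) × 𝔸^B` with `𝔸^M`, a subset of `ℙ(K^A) × 𝔸^(B ⊕ M)`. -/
def prodAffine (s : Coords K X A B) (M : Type*) : Coords K (X × (M → K)) A (B ⊕ M) where
  hom p := s.hom p.1
  aff p := Sum.elim (s.aff p.1) p.2

end Coords

/-- The affine space `𝔸^M`. -/
def affineSpace (K : Type u) (M : Type*) : Coords K (M → K) Empty M where
  hom _ i := i.elim
  aff c := c

/-- The subset `Z` of affine space, with the induced structure. -/
def affineSubset (Z : Set (M → K)) : Coords K Z Empty M :=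
  (affineSpace K M).comap Subtype.val

/-- Morphisms: Zariski continuous maps that pull regular functions back to regular functions. -/
structure IsMorphism (s : Coords K X A B) (t : Coords K Y A' B') (φ : X → Y) : Prop where
  continuous : ∀ Z, t.IsClosed Z → s.IsClosed (φ ⁻¹' Z)
  regular : ∀ (U : Set Y) (f : Y → K), t.IsOpen U → t.IsRegularOn U f →
    s.IsRegularOn (φ ⁻¹' U) (f ∘ φ)

/-- Isomorphisms: bijections that are morphisms in both directions. -/
structure Iso (s : Coords K X A B) (t : Coords K Y A' B') extends X ≃ Y where
  isMorphism : IsMorphism s t toFun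
  isMorphism_symm : IsMorphism t s invFun

/-- `X` is an affine variety: it is isomorphic to a closed subset of some affine space. -/
def IsAffineVariety (s : Coords K X A B) : Prop :=
  ∃ (n : ℕ) (Z : Set (Fin n → K)), (affineSpace K (Fin n)).IsClosed Z ∧
    Nonempty (Iso s (affineSubset Z))

/-- The Grassmannian of `k`-dimensional subspaces of `E`. -/
def Grassmannian (K : Type u) [Field K] (E : Type*) [AddCommGroup E] [Module K E] (k : ℕ) :=
  {W : Submodule K E // Module.finrank K W = k}

/-- The Plücker embedding, free of bases: the homogeneous coordinate of a subspace `W` with basis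
`w₁, …, w_k` which belongs to the alternating form `ω` is `ω(w₁, …, w_k)`. Another basis of `W`
multiplies all the coordinates by one nonzero scalar. -/
noncomputable def plucker (K : Type u) [Field K] (E : Type*) [AddCommGroup E] [Module K E]
    [Module.Finite K E] (k : ℕ) :
    Coords K (Grassmannian K E k) (E [⋀^Fin k]→ₗ[K] K) Empty where
  hom W ω := ω fun j => (Module.finBasisOfFinrankEq K W.1 W.2 j : E)
  aff _ i := i.elim

end QP

/-! ## Path algebras and their admissible quotients -/

namespace BoundQuiver

/-- The paths of a quiver, of any length `≥ 0`. -/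
structure AnyPath (V : Type v) [Quiver.{w + 1} V] where
  src : V
  tgt : V
  path : Quiver.Path src tgt

section PathAlgebra

variable (K : Type u) [Field K] (V : Type v) [Quiver.{w + 1} V]

/-- The path algebra: the vector space with basis the set of all paths. -/
def PathAlgebra := AnyPath V →₀ K

noncomputable instance : AddCommGroup (PathAlgebra K V) :=
  inferInstanceAs (AddCommGroup (AnyPath V →₀ K))

noncomputable instance : Module K (PathAlgebra K V) :=
  inferInstanceAs (Module K (AnyPath V →₀ K))

namespace PathAlgebra

variable {V}

/-- The basis element that belongs to a path. -/
noncomputable def of (p : AnyPath V) : PathAlgebra K V := Finsupp.single p 1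

variable {K}

/-- The coefficient of a path in an element of the path algebra. -/
def coeff (x : PathAlgebra K V) (p : AnyPath V) : K := (show AnyPath V →₀ K from x) p

@[elab_as_elim]
theorem induction_on {C : PathAlgebra K V → Prop} (x : PathAlgebra K V) (zero : C 0)
    (add : ∀ x y, C x → C y → C (x + y)) (smul_of : ∀ (a : K) (p : AnyPath V), C (a • of K p)) :
    C x := by
  refine Finsupp.induction_linear x zero add fun p a => ?_
  have h := smul_of a p
  have e : a • of K p = Finsupp.single p a := by
    refine (Finsupp.smul_single a p (1 : K)).trans ?_
    simp
  rwa [e] at h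

variable (K)

open Classical in
/-- The product `p q` of two paths is "first `q`, then `p`"; it is zero unless the end point of `q`
is the starting point of `p`. -/
noncomputable def pathMul (p q : AnyPath V) : PathAlgebra K V :=
  if h : p.src = q.tgt then of K ⟨q.src, p.tgt, q.path.comp (p.path.cast h rfl)⟩ else 0

/-- The bilinear extension of the product of paths. -/
noncomputable def mulLin : PathAlgebra K V →ₗ[K] PathAlgebra K V →ₗ[K] PathAlgebra K V :=
  Finsupp.linearCombination K fun p => Finsupp.linearCombination K fun q => pathMul K p q

noncomputable instance : Mul (PathAlgebra K V) := ⟨fun x y => mulLin K x y⟩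

theorem mul_def (x y : PathAlgebra K V) : x * y = mulLin K x y := rfl

theorem of_mul_of (p q : AnyPath V) : of K p * of K q = pathMul K p q := by
  have h1 : mulLin K (of K p) = Finsupp.linearCombination K fun q => pathMul K p q :=
    (Finsupp.linearCombination_single K (1 : K) p).trans (one_smul K _)
  have h2 : (Finsupp.linearCombination K fun q => pathMul K p q) (Finsupp.single q 1) =
      pathMul K p q := (Finsupp.linearCombination_single K (1 : K) q).trans (one_smul K _)
  rw [mul_def, h1]
  exact h2

theorem smul_mul' (a : K) (x y : PathAlgebra K V) : (a • x) * y = a • (x * y) := by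
  simp [mul_def]

theorem mul_smul' (a : K) (x y : PathAlgebra K V) : x * (a • y) = a • (x * y) := by
  simp [mul_def]

noncomputable instance : NonUnitalNonAssocRing (PathAlgebra K V) :=
  { (inferInstance : AddCommGroup (PathAlgebra K V)),
    (inferInstance : Mul (PathAlgebra K V)) with
    left_distrib := fun x y t => by simp [mul_def]
    right_distrib := fun x y t => by simp [mul_def]
    zero_mul := fun x => by simp [mul_def]
    mul_zero := fun x => by simp [mul_def] }

theorem pathMul_assoc (p q r : AnyPath V) :
    pathMul K p q * of K r = of K p * pathMul K q r := by
  obtain ⟨a, b, p⟩ := p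
  obtain ⟨a', b', q⟩ := q
  obtain ⟨a'', b'', r⟩ := r
  unfold pathMul
  by_cases h : a = b'
  · subst h
    by_cases h' : a' = b''
    · subst h'
      simp [of_mul_of, pathMul, Quiver.Path.comp_assoc]
    · simp [of_mul_of, pathMul, h']
  · by_cases h' : a' = b''
    · subst h'
      simp [of_mul_of, pathMul, h]
    · simp [h, h']

theorem mul_assoc' (x y t : PathAlgebra K V) : x * y * t = x * (y * t) := by
  induction x using induction_on with
  | zero => simp
  | add x x' hx hx' => simp only [add_mul, hx, hx']
  | smul_of a p =>
    induction y using induction_on with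
    | zero => simp
    | add y y' hy hy' => simp only [add_mul, mul_add, hy, hy']
    | smul_of b q =>
      induction t using induction_on with
      | zero => simp
      | add t t' ht ht' => simp only [mul_add, ht, ht']
      | smul_of c r => simp only [smul_mul', mul_smul', of_mul_of, pathMul_assoc]

variable [Fintype V]

noncomputable instance : One (PathAlgebra K V) := ⟨∑ i : V, of K ⟨i, i, .nil⟩⟩

theorem one_def : (1 : PathAlgebra K V) = ∑ i : V, of K ⟨i, i, .nil⟩ := rfl

theorem one_mul_of (p : AnyPath V) : 1 * of K p = of K p := by
  classical
  obtain ⟨a, b, p⟩ := p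
  rw [one_def, Finset.sum_mul, Finset.sum_eq_single b]
  · simp [of_mul_of, pathMul, Quiver.Path.cast]
  · intro i _ hi
    simp [of_mul_of, pathMul, hi]
  · simp

theorem of_mul_one (p : AnyPath V) : of K p * 1 = of K p := by
  classical
  obtain ⟨a, b, p⟩ := p
  rw [one_def, Finset.mul_sum, Finset.sum_eq_single a]
  · simp [of_mul_of, pathMul]
  · intro i _ hi
    simp [of_mul_of, pathMul, hi.symm]
  · simp

/-- The path algebra is a ring; its identity is the sum of the paths of length zero. -/
noncomputable instance : Ring (PathAlgebra K V) :=
  { (inferInstance : NonUnitalNonAssocRing (PathAlgebra K V)),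
    (inferInstance : One (PathAlgebra K V)) with
    mul_assoc := mul_assoc' K
    one_mul := fun x => by
      induction x using induction_on with
      | zero => exact mul_zero _
      | add x y hx hy => exact (mul_add _ x y).trans (congrArg₂ _ hx hy)
      | smul_of a p => exact (mul_smul' K a _ _).trans (congrArg _ (one_mul_of K p))
    mul_one := fun x => by
      induction x using induction_on with
      | zero => exact zero_mul _
      | add x y hx hy => exact (add_mul x y _).trans (congrArg₂ _ hx hy)
      | smul_of a p => exact (smul_mul' K a _ _).trans (congrArg _ (of_mul_one K p)) }

noncomputable instance : Algebra K (PathAlgebra K V) :=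
  Algebra.ofModule (smul_mul' K) (mul_smul' K)

end PathAlgebra

/-- The ideal `I` of the path algebra is admissible: it contains all paths from some length on, and
all its elements are linear combinations of paths of length at least two. -/
class IsAdmissible {K : Type u} [Field K] {V : Type v} [Quiver.{w + 1} V] [Fintype V]
    (I : Ideal (PathAlgebra K V)) : Prop where
  exists_mem : ∃ m : ℕ, ∀ p : AnyPath V, m ≤ p.path.length → PathAlgebra.of K p ∈ I
  two_le_length : ∀ x ∈ I, ∀ p : AnyPath V, x.coeff p ≠ 0 → 2 ≤ p.path.length

end PathAlgebra

section Algebra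

variable {K : Type u} [Field K] {V : Type v} [Quiver.{w + 1} V] [Fintype V]
variable (I : Ideal (PathAlgebra K V)) [I.IsTwoSided]

/-- The residue class in `Λ = KΓ/I` of a path. -/
noncomputable def pathClass (p : AnyPath V) : PathAlgebra K V ⧸ I :=
  Ideal.Quotient.mk I (PathAlgebra.of K p)

/-- The primitive idempotent of `Λ` that belongs to a vertex. -/
noncomputable def vtx (i : V) : PathAlgebra K V ⧸ I := pathClass I ⟨i, i, .nil⟩

theorem finite_paths [∀ a b : V, Finite (a ⟶ b)] (m : ℕ) :
    {p : AnyPath V | p.path.length < m}.Finite := by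
  induction m with
  | zero => simp
  | succ m ih =>
    have : Finite {p : AnyPath V | p.path.length < m} := ih
    let f : V ⊕ (Σ (p : {p : AnyPath V | p.path.length < m}) (b : V), (p.1.tgt ⟶ b)) →
        AnyPath V := fun t => match t with
      | .inl i => ⟨i, i, .nil⟩
      | .inr ⟨p, b, a⟩ => ⟨p.1.src, b, p.1.path.cons a⟩
    refine (Set.finite_range f).subset ?_
    rintro ⟨a, b, p⟩ hp
    cases p with
    | nil => exact ⟨.inl a, rfl⟩
    | cons p e =>
      exact ⟨.inr ⟨⟨⟨a, _, p⟩, by simpa using hp⟩, b, e⟩, rfl⟩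

instance finite_quotient [∀ a b : V, Finite (a ⟶ b)] [IsAdmissible I] :
    Module.Finite K (PathAlgebra K V ⧸ I) := by
  obtain ⟨m, hm⟩ := IsAdmissible.exists_mem (I := I)
  refine ⟨⟨((finite_paths (V := V) m).image (pathClass I)).toFinset, ?_⟩⟩
  rw [Set.Finite.coe_toFinset, eq_top_iff]
  rintro x -
  obtain ⟨x, rfl⟩ := Ideal.Quotient.mk_surjective x
  induction x using PathAlgebra.induction_on with
  | zero => simp
  | add x y hx hy => rw [map_add]; exact Submodule.add_mem _ hx hy
  | smul_of a p =>
    have : Ideal.Quotient.mk I (a • PathAlgebra.of K p) = a • pathClass I p := rfl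
    rw [this]
    refine Submodule.smul_mem _ _ ?_
    by_cases hp : p.path.length < m
    · exact Submodule.subset_span ⟨p, hp, rfl⟩
    · have : pathClass I p = 0 := Ideal.Quotient.eq_zero_iff_mem.2 (hm p (not_lt.1 hp))
      rw [this]
      exact Submodule.zero_mem _

/-- The Jacobson radical `J` of `Λ`. -/
noncomputable abbrev rad : Ideal (PathAlgebra K V ⧸ I) := Ring.jacobson (PathAlgebra K V ⧸ I)

/-- The number `L` such that `L + 1` is the nilpotency index of the Jacobson radical. -/
noncomputable def loewy : ℕ := sInf {l : ℕ | rad I ^ (l + 1) = ⊥}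

/-- The submodule `J ^ l M` of a `Λ`-module. -/
noncomputable def radPow (M : Type*) [AddCommGroup M] [Module (PathAlgebra K V ⧸ I) M] (l : ℕ) :
    Submodule (PathAlgebra K V ⧸ I) M := rad I ^ l • ⊤

/-- The number of composition factors `S_i` of a finite dimensional `Λ`-module, which is the
dimension of `e_i M`. -/
noncomputable def dimVec (M : Type*) [AddCommGroup M] [Module K M]
    [Module (PathAlgebra K V ⧸ I) M] [IsScalarTower K (PathAlgebra K V ⧸ I) M] (i : V) : ℕ :=
  Module.finrank K (LinearMap.range (Algebra.lsmul K K M (vtx I i)))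

/-! ## Distinguished projective modules and skeleta -/

variable {ι : Type z} (e : ι → V)

/-- The projective module `Q = ⨁ r, Λ e(r)`. -/
abbrev Proj : Type _ := (r : ι) → ↥(Ideal.span {vtx I (e r)})

open Classical in
/-- The distinguished top elements `z_r` of `Q`. -/
noncomputable def topElt (r : ι) : Proj I e :=
  Pi.single r ⟨vtx I (e r), Ideal.subset_span rfl⟩

instance finite_proj [∀ a b : V, Finite (a ⟶ b)] [IsAdmissible I] [Finite ι] :
    Module.Finite K (Proj I e) := by
  have (r : ι) : Module.Finite K ↥(Ideal.span {vtx I (e r)}) :=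
    inferInstanceAs (Module.Finite K ((Ideal.span {vtx I (e r)}).restrictScalars K))
  infer_instance

/-- A path `p ẑ_r` in the projective `KΓ`-module `Q̂ = ⨁ r, KΓ ẑ_r`. -/
structure TopPath (e : ι → V) where
  root : ι
  tgt : V
  path : Quiver.Path (e root) tgt

namespace TopPath

variable {e}

/-- The length of a path `p ẑ_r`. -/
def length (x : TopPath e) : ℕ := x.path.length

/-- The path `ẑ_r` of length zero. -/
def top (e : ι → V) (r : ι) : TopPath e := ⟨r, e r, .nil⟩

/-- `x` is an initial subpath of `y`. -/
def IsInitial (x y : TopPath e) : Prop :=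
  ∃ q : Quiver.Path x.tgt y.tgt, y = ⟨x.root, y.tgt, x.path.comp q⟩

/-- The element `p x_r` of `M` that belongs to the path `p ẑ_r`, for elements `x_r` of `M`. -/
noncomputable def act {M : Type*} [AddCommGroup M] [Module (PathAlgebra K V ⧸ I) M]
    (y : TopPath e) (x : ι → M) : M :=
  pathClass I ⟨_, _, y.path⟩ • x y.root

/-- The element `p z_r` of `Q` that belongs to the path `p ẑ_r`. -/
noncomputable def elt (y : TopPath e) : Proj I e := y.act I (topElt I e)

end TopPath

variable {e}

/-- Abstract skeleta in `Q̂`, with top `⨁ i, S_i ^ (t i)` and dimension vector `d`: sets of paths of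
length at most `L` that are closed under initial subpaths. (Such sets are finite.) -/
structure IsSkeleton (t d : V → ℕ) (σ : Finset (TopPath e)) : Prop where
  length_le : ∀ y ∈ σ, y.length ≤ loewy I
  initial_mem : ∀ x y : TopPath e, x.IsInitial y → y ∈ σ → x ∈ σ
  card_top : ∀ i : V, {r : ι | TopPath.top e r ∈ σ ∧ e r = i}.ncard = t i
  card_tgt : ∀ i : V, {y : TopPath e | y ∈ σ ∧ y.tgt = i}.ncard = d i

/-- The indices `r` for which the path `ẑ_r` of length zero belongs to `σ`. -/
abbrev Root (σ : Finset (TopPath e)) : Type z := {r : ι // TopPath.top e r ∈ σ}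

/-- The set `σ` is a skeleton of the `Λ`-module `M` relative to the family of the elements `x r` of
`M`, where `r` runs through the roots of `σ`: these are a full sequence of top elements of `M`, each
normed by the right idempotent, and for each `l ≤ L` the elements `p x_r`, with `p ẑ_r` of length
`l` in `σ`, induce a basis of `J ^ l M / J ^ (l + 1) M`. (For other `r`, the element `x r` is
irrelevant.) -/
structure IsSkeletonRel (σ : Finset (TopPath e)) {M : Type*} [AddCommGroup M] [Module K M]
    [Module (PathAlgebra K V ⧸ I) M] [IsScalarTower K (PathAlgebra K V ⧸ I) M]
    (x : ι → M) : Prop where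
  normed : ∀ r : Root σ, vtx I (e r) • x r = x r
  notMem_rad : ∀ r : Root σ, x r ∉ radPow I M 1
  span_eq_top :
    Submodule.span (PathAlgebra K V ⧸ I) (Set.range fun r : Root σ => x r) = ⊤
  linearIndependent_top :
    LinearIndependent K fun r : Root σ => (radPow I M 1).mkQ (x r)
  layer_span : ∀ l ≤ loewy I,
    (radPow I M l).restrictScalars K =
      Submodule.span K (Set.range fun y : {y : TopPath e // y ∈ σ ∧ y.length = l} => y.1.act I x) ⊔
        (radPow I M (l + 1)).restrictScalars K
  layer_linearIndependent : ∀ l ≤ loewy I,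
    LinearIndependent K fun y : {y : TopPath e // y ∈ σ ∧ y.length = l} =>
      (radPow I M (l + 1)).mkQ (y.1.act I x)

/-- The set `σ` is a skeleton of the `Λ`-module `M`. -/
def HasSkeleton (σ : Finset (TopPath e)) (M : Type*) [AddCommGroup M] [Module K M]
    [Module (PathAlgebra K V ⧸ I) M] [IsScalarTower K (PathAlgebra K V ⧸ I) M] : Prop :=
  ∃ x : ι → M, IsSkeletonRel I σ x

/-- The set `σ` is a distinguished skeleton of `Q/C`: it is a skeleton relative to the residue
classes of the distinguished top elements. -/
def IsDistinguished (σ : Finset (TopPath e)) (C : Submodule (PathAlgebra K V ⧸ I) (Proj I e)) :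
    Prop :=
  IsSkeletonRel I σ fun r => C.mkQ (topElt I e r)

/-! ## Critical paths -/

/-- The `σ`-critical paths: paths of length at most `L` outside `σ` all of whose proper initial
subpaths belong to `σ`. -/
abbrev CritPath (σ : Finset (TopPath e)) :=
  {y : TopPath e // y ∉ σ ∧ y.length ≤ loewy I ∧ ∀ x : TopPath e, x.IsInitial y → x ≠ y → x ∈ σ}

open Classical in
/-- The `σ`-set of a path `y`: the paths in `σ` which are at least as long as `y` and end in the
same vertex. -/
noncomputable def sigmaSet (σ : Finset (TopPath e)) (y : TopPath e) : Finset (TopPath e) :=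
  {q ∈ σ | y.length ≤ q.length ∧ q.tgt = y.tgt}

/-- The index set `N` of pairs of a critical path and a member of its `σ`-set. -/
abbrev IndexN (σ : Finset (TopPath e)) := Σ y : CritPath I σ, ↥(sigmaSet σ y.1)

/-- The subset `N₀` of `N` that belongs to the critical paths of length zero. -/
abbrev IndexN₀ (σ : Finset (TopPath e)) := {ν : IndexN I σ // ν.1.1.length = 0}

variable {I}

/-- The element `u z_r - ∑ c_{u ẑ_r, q ẑ_s} q z_s` of `Q`, for a critical path `u ẑ_r`. -/
noncomputable def critElt {σ : Finset (TopPath e)} (c : IndexN I σ → K) (y : CritPath I σ) :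
    Proj I e :=
  y.1.elt I - ∑ q : ↥(sigmaSet σ y.1), c ⟨y, q⟩ • q.1.elt I

/-- The submodule `U(c)` of `Q`. -/
noncomputable def submoduleU {σ : Finset (TopPath e)} (c : IndexN I σ → K) :
    Submodule (PathAlgebra K V ⧸ I) (Proj I e) :=
  Submodule.span _ (Set.range (critElt c))

/-- The family `c` is a family of coefficients of `C`: in `Q/C`, each critical path `u z_r` equals
the combination `∑ c_{u ẑ_r, q ẑ_s} q z_s` of the members of its `σ`-set. -/
def IsCoeff {σ : Finset (TopPath e)} (C : Submodule (PathAlgebra K V ⧸ I) (Proj I e))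
    (c : IndexN I σ → K) : Prop :=
  ∀ y : CritPath I σ, C.mkQ (y.1.elt I) =
    ∑ q : ↥(sigmaSet σ y.1), c ⟨y, q⟩ • C.mkQ (q.1.elt I)

/-! ## The varieties -/

variable (I)

/-- The structure of a quasi-projective set on a set of `Λ`-submodules of `Q` all of which have
dimension `k`: the one induced by the Grassmannian of `k`-dimensional subspaces of `Q`. -/
noncomputable def submoduleCoords [∀ a b : V, Finite (a ⟶ b)] [IsAdmissible I] [Finite ι] (k : ℕ)
    (S : Set (Submodule (PathAlgebra K V ⧸ I) (Proj I e)))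
    (hS : ∀ C ∈ S, Module.finrank K (C.restrictScalars K) = k) :
    QP.Coords K S (Proj I e [⋀^Fin k]→ₗ[K] K) Empty :=
  (QP.plucker K (Proj I e) k).comap fun C => ⟨C.1.restrictScalars K, hS C.1 C.2⟩

/-- The norming vertices of the distinguished projective cover of `⨁ i, S_i ^ (d i)`: the vertex `i`
occurs `d i` times. -/
abbrev bigTop (d : V → ℕ) : (Σ i : V, Fin (d i)) → V := Sigma.fst

/-- The set `GRASS(σ)`, for `σ ⊆ 𝐏̂`: the submodules `C` of dimension `dim 𝐏 - |d|` of the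
distinguished projective cover `𝐏` of `⨁ i, S_i ^ (d i)` such that `𝐏/C` has dimension vector `d` and
`σ` is a distinguished skeleton of `𝐏/C`. -/
def BigGrass (d : V → ℕ) (σ : Finset (TopPath (bigTop d))) :
    Set (Submodule (PathAlgebra K V ⧸ I) (Proj I (bigTop d))) :=
  {C | Module.finrank K (C.restrictScalars K) =
      Module.finrank K (Proj I (bigTop d)) - ∑ i, d i ∧
    dimVec I (Proj I (bigTop d) ⧸ C) = d ∧ IsDistinguished I σ C}

/-- The norming vertices of the distinguished projective cover `P = ⨁ Λ z_r` of the top of `σ`, where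
`r` runs through the roots of `σ`. -/
abbrev smallTop (σ : Finset (TopPath e)) : Root σ → V := fun r => e r.1

/-- The embedding of the paths in `P̂` into the paths in `Q̂`. -/
def embedPath (σ : Finset (TopPath e)) (y : TopPath (smallTop σ)) : TopPath e :=
  ⟨y.root.1, y.tgt, y.path⟩

set_option linter.unusedSectionVars false in
theorem embedPath_injective (σ : Finset (TopPath e)) : Function.Injective (embedPath σ) := by
  rintro ⟨⟨r, hr⟩, b, p⟩ ⟨⟨r', hr'⟩, b', p'⟩ h
  simp only [embedPath, TopPath.mk.injEq] at h
  obtain ⟨rfl, rfl, h⟩ := h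
  simpa using h

/-- The set `σ` as a set of paths in `P̂`. -/
noncomputable def smallSkeleton (σ : Finset (TopPath e)) : Finset (TopPath (smallTop σ)) :=
  σ.preimage (embedPath σ) (embedPath_injective σ).injOn

/-- The set `Grass(σ)`: the submodules `C` of dimension `dim P - |d|` of `P` such that `C` is
contained in `J P` and `σ` is a distinguished skeleton of `P/C`. -/
def SmallGrass (d : V → ℕ) (σ : Finset (TopPath e)) :
    Set (Submodule (PathAlgebra K V ⧸ I) (Proj I (smallTop σ))) :=
  {C | Module.finrank K (C.restrictScalars K) =
      Module.finrank K (Proj I (smallTop σ)) - ∑ i, d i ∧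
    C ≤ radPow I (Proj I (smallTop σ)) 1 ∧ IsDistinguished I (smallSkeleton σ) C}

section

variable [∀ a b : V, Finite (a ⟶ b)] [IsAdmissible I]

/-- `GRASS(σ)` as a subset of the Grassmannian of `𝐏`. -/
noncomputable def bigGrass (d : V → ℕ) (σ : Finset (TopPath (bigTop d))) :
    QP.Coords K (BigGrass I d σ)
      (Proj I (bigTop d) [⋀^Fin (Module.finrank K (Proj I (bigTop d)) - ∑ i, d i)]→ₗ[K] K) Empty :=
  submoduleCoords I _ (BigGrass I d σ) fun _ h => h.1

/-- `Grass(σ)` as a subset of the Grassmannian of `P`. -/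
noncomputable def smallGrass [Finite ι] (d : V → ℕ) (σ : Finset (TopPath e)) :
    QP.Coords K (SmallGrass I d σ)
      (Proj I (smallTop σ) [⋀^Fin (Module.finrank K (Proj I (smallTop σ)) - ∑ i, d i)]→ₗ[K] K)
      Empty :=
  submoduleCoords I _ (SmallGrass I d σ) fun _ h => h.1

end

/-! ## Isomorphism types -/

/-- The isomorphism type of a module. -/
def isoType (R : Type*) [Ring R] (M : Type m) [AddCommGroup M] [Module R M] :
    Quotient (CategoryTheory.isIsomorphicSetoid (ModuleCat.{m} R)) :=
  Quotient.mk _ (ModuleCat.of R M)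

/-- The set of the isomorphism types of `Λ`-modules with skeleton `σ`. -/
def skeletonTypes (σ : Finset (TopPath e)) :
    Set (Quotient (CategoryTheory.isIsomorphicSetoid (ModuleCat.{m} (PathAlgebra K V ⧸ I)))) :=
  {X | ∃ (M : Type m) (_ : AddCommGroup M) (_ : Module K M) (_ : Module (PathAlgebra K V ⧸ I) M)
    (_ : IsScalarTower K (PathAlgebra K V ⧸ I) M),
    X = isoType (PathAlgebra K V ⧸ I) M ∧ HasSkeleton I σ M}

end Algebra

end BoundQuiver

open BoundQuiver

set_option linter.unusedSectionVars false

/-! The coordinates come from rewriting. If `σ` is a distinguished skeleton of `𝐏/C`, the elements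
`q z_s` with `q ẑ_s` in `σ` form a `K`-basis of `𝐏/C`, and those of length at least `l` span
`J^l(𝐏/C)`. After multiplication by the idempotent of its end vertex, each critical path is
therefore a unique combination of its `σ`-set (`IsDistinguished.existsUnique_isCoeff`). Conversely,
a path of `σ` extended by an arrow is in `σ`, critical or zero, so the relations alone make `σ` span
`𝐏/U(c)`. Since `U(c) ⊆ C` and `σ` is independent modulo `C`, the coefficients recover `C`
(`IsCoeff.eq_submoduleU`).

A family `c` prescribes a matrix for every arrow on `K^σ`, hence a representation `rep c` of the
path algebra. The families that come from submodules are those whose representation kills `I`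
(`IsGood`). This is necessary because elements of `I` act as zero on a quotient with basis `σ`
(`IsRelated.isGood`). It is sufficient because a good `c` makes `K^σ` a `Λ`-module, and the kernel
of the resulting map from `𝐏` is the required submodule (`isCoeff_kerSubmodule`,
`isDistinguished_kerSubmodule`). The matrix entries are polynomials in `c`, and left generators of
`I` suffice for the test. This gives closedness and the field of definition.

Both directions are algebraic. By Cramer's rule the coefficients are quotients of Plücker
coordinates of `C` (`formMap_coeff`). Projecting a basis of one fixed `C₀` along the span of `σ`
gives a basis of `U(c)` that is polynomial in `c` (`formMap_submoduleU`).

Finally, `N` is the disjoint union of `N₀` and the index set of `σ` viewed in `P̂`. Arrow matrices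
only see paths of positive length, so goodness does not involve the coordinates in `N₀`
(`isGood_embedIndex`), and an affine space splits off. -/

namespace QP

/-! ### Maps given by forms, and the morphisms they define. -/

variable {K : Type u} [Field K] {X Y Z A B A' B' A'' B'' M : Type*}

/-- The map `φ` is given by forms in the coordinates: up to a common unit, the homogeneous
coordinates of `φ x` are the values of forms of the same degree, and the affine coordinates of `φ x`
are quotients of forms of the same degree with a common denominator that vanishes nowhere. -/
def FormMap (s : Coords K X A B) (t : Coords K Y A' B') (φ : X → Y) : Prop :=
  ∃ (n m : ℕ) (H : A' → MvPolynomial (A ⊕ B) K) (G : B' → MvPolynomial (A ⊕ B) K)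
    (D : MvPolynomial (A ⊕ B) K) (l : X → K),
    (∀ a, IsForm (H a) n) ∧ (∀ b, IsForm (G b) m) ∧ IsForm D m ∧
    (∀ x, l x ≠ 0) ∧ (∀ x, s.eval D x ≠ 0) ∧
    (∀ x a, s.eval (H a) x = l x * t.hom (φ x) a) ∧
    (∀ x b, s.eval (G b) x = s.eval D x * t.aff (φ x) b)

theorem isForm_mul {P Q : MvPolynomial (A ⊕ B) K} {n m : ℕ} (hP : IsForm P n) (hQ : IsForm Q m) :
    IsForm (P * Q) (n + m) :=
  MvPolynomial.IsWeightedHomogeneous.mul hP hQ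

theorem isForm_pow {P : MvPolynomial (A ⊕ B) K} {n : ℕ} (hP : IsForm P n) (k : ℕ) :
    IsForm (P ^ k) (k * n) := by
  have := MvPolynomial.IsWeightedHomogeneous.pow hP k
  rwa [smul_eq_mul] at this

theorem isForm_add {P Q : MvPolynomial (A ⊕ B) K} {n : ℕ} (hP : IsForm P n) (hQ : IsForm Q n) :
    IsForm (P + Q) n :=
  MvPolynomial.IsWeightedHomogeneous.add hP hQ

theorem isForm_zero (n : ℕ) : IsForm (0 : MvPolynomial (A ⊕ B) K) n :=
  MvPolynomial.isWeightedHomogeneous_zero _ _ _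

theorem isForm_one : IsForm (1 : MvPolynomial (A ⊕ B) K) 0 :=
  MvPolynomial.isWeightedHomogeneous_one _ _

theorem isForm_rename_inr (P : MvPolynomial B K) :
    IsForm (MvPolynomial.rename Sum.inr P : MvPolynomial (A ⊕ B) K) 0 := by
  induction P using MvPolynomial.induction_on with
  | C a => rw [MvPolynomial.rename_C]; exact MvPolynomial.isWeightedHomogeneous_C _ _
  | add p q hp hq => rw [map_add]; exact isForm_add hp hq
  | mul_X p b hp =>
    rw [map_mul, MvPolynomial.rename_X]
    exact isForm_mul hp (MvPolynomial.isWeightedHomogeneous_X K _ (Sum.inr b))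

namespace Coords

variable (s : Coords K X A B)

@[simp] theorem eval_add (P Q : MvPolynomial (A ⊕ B) K) (x : X) :
    s.eval (P + Q) x = s.eval P x + s.eval Q x := map_add _ _ _

@[simp] theorem eval_mul (P Q : MvPolynomial (A ⊕ B) K) (x : X) :
    s.eval (P * Q) x = s.eval P x * s.eval Q x := map_mul _ _ _

@[simp] theorem eval_pow (P : MvPolynomial (A ⊕ B) K) (k : ℕ) (x : X) :
    s.eval (P ^ k) x = s.eval P x ^ k := map_pow _ _ _

@[simp] theorem eval_zero (x : X) : s.eval 0 x = 0 := map_zero _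

@[simp] theorem eval_one (x : X) : s.eval 1 x = 1 := map_one _

@[simp] theorem eval_C (a : K) (x : X) : s.eval (MvPolynomial.C a) x = a := MvPolynomial.eval_C _

@[simp] theorem eval_X_inl (a : A) (x : X) : s.eval (MvPolynomial.X (.inl a)) x = s.hom x a :=
  MvPolynomial.eval_X _

@[simp] theorem eval_X_inr (b : B) (x : X) : s.eval (MvPolynomial.X (.inr b)) x = s.aff x b :=
  MvPolynomial.eval_X _

@[simp] theorem eval_rename_inr (P : MvPolynomial B K) (x : X) :
    s.eval (MvPolynomial.rename Sum.inr P) x = MvPolynomial.eval (s.aff x) P := by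
  simp [eval, MvPolynomial.eval_rename, Function.comp_def]

end Coords

section Pullback

variable {s : Coords K X A B} {t : Coords K Y A' B'} {φ : X → Y}
  {n m : ℕ} {H : A' → MvPolynomial (A ⊕ B) K} {G : B' → MvPolynomial (A ⊕ B) K}
  {D : MvPolynomial (A ⊕ B) K} {l : X → K}

/-- Each homogeneous variable costs a factor `l`, each affine variable a denominator `D`. The
exponent `N` is left free above a bound so that the monomials of one form can later be brought to
the same power of `D`. -/
theorem exists_pullback_monomial (hH : ∀ a, IsForm (H a) n) (hG : ∀ b, IsForm (G b) m)
    (hD : IsForm D m) (eH : ∀ x a, s.eval (H a) x = l x * t.hom (φ x) a)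
    (eG : ∀ x b, s.eval (G b) x = s.eval D x * t.aff (φ x) b) (μ : A' ⊕ B' →₀ ℕ) :
    ∃ N₀, ∀ N, N₀ ≤ N → ∃ P, IsForm P
        (Finsupp.weight (Sum.elim (fun _ => 1) (fun _ => 0) : A' ⊕ B' → ℕ) μ * n + N * m) ∧
      ∀ x, s.eval P x = l x ^ Finsupp.weight (Sum.elim (fun _ => 1) (fun _ => 0) : A' ⊕ B' → ℕ) μ *
        s.eval D x ^ N * t.eval (MvPolynomial.monomial μ 1) (φ x) := by
  induction μ using Finsupp.induction_linear with
  | zero =>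
    refine ⟨0, fun N _ => ⟨D ^ N, ?_, fun x => ?_⟩⟩
    · simpa using isForm_pow hD N
    · simp [Coords.eval]
  | add μ ν hμ hν =>
    obtain ⟨N₁, h₁⟩ := hμ
    obtain ⟨N₂, h₂⟩ := hν
    refine ⟨N₁ + N₂, fun N hN => ?_⟩
    obtain ⟨P, hP, eP⟩ := h₁ N₁ le_rfl
    obtain ⟨Q, hQ, eQ⟩ := h₂ (N - N₁) (by omega)
    refine ⟨P * Q, ?_, fun x => ?_⟩
    · convert isForm_mul hP hQ using 1
      rw [map_add]
      obtain ⟨N', rfl⟩ := Nat.exists_eq_add_of_le (show N₁ ≤ N by omega)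
      simp
      ring
    · have : (MvPolynomial.monomial (μ + ν) 1 : MvPolynomial (A' ⊕ B') K) =
          MvPolynomial.monomial μ 1 * MvPolynomial.monomial ν 1 := by
        rw [MvPolynomial.monomial_mul, one_mul]
      obtain ⟨N', rfl⟩ := Nat.exists_eq_add_of_le (show N₁ ≤ N by omega)
      rw [Coords.eval_mul, eP, eQ, this, Coords.eval_mul, map_add, Nat.add_sub_cancel_left,
        pow_add, pow_add]
      ring
  | single i k =>
    have hw : Finsupp.weight (Sum.elim (fun _ => 1) (fun _ => 0) : A' ⊕ B' → ℕ)
        (Finsupp.single i k) = k * (Sum.elim (fun _ => 1) (fun _ => 0) : A' ⊕ B' → ℕ) i := by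
      rw [Finsupp.weight_single, smul_eq_mul]
    have hm : (MvPolynomial.monomial (Finsupp.single i k) 1 : MvPolynomial (A' ⊕ B') K) =
        MvPolynomial.X i ^ k := by
      rw [MvPolynomial.X_pow_eq_monomial]
    rw [hw, hm]
    rcases i with a | b
    · refine ⟨0, fun N _ => ⟨H a ^ k * D ^ N, ?_, fun x => ?_⟩⟩
      · simpa using isForm_mul (isForm_pow (hH a) k) (isForm_pow hD N)
      · simp only [Coords.eval_mul, Coords.eval_pow, eH, Coords.eval_X_inl, Sum.elim_inl, mul_one,
          mul_pow]
        ring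
    · refine ⟨k, fun N hN => ⟨G b ^ k * D ^ (N - k), ?_, fun x => ?_⟩⟩
      · convert isForm_mul (isForm_pow (hG b) k) (isForm_pow hD (N - k)) using 1
        obtain ⟨N', rfl⟩ := Nat.exists_eq_add_of_le hN
        simp
        ring
      · obtain ⟨N', rfl⟩ := Nat.exists_eq_add_of_le hN
        simp only [Coords.eval_mul, Coords.eval_pow, eG, Coords.eval_X_inr, Sum.elim_inr, mul_zero,
          mul_pow, pow_zero, Nat.add_sub_cancel_left, pow_add]
        ring

theorem exists_pullback (hH : ∀ a, IsForm (H a) n) (hG : ∀ b, IsForm (G b) m)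
    (hD : IsForm D m) (eH : ∀ x a, s.eval (H a) x = l x * t.hom (φ x) a)
    (eG : ∀ x b, s.eval (G b) x = s.eval D x * t.aff (φ x) b)
    {F : MvPolynomial (A' ⊕ B') K} {k : ℕ} (hF : IsForm F k) :
    ∃ N₀, ∀ N, N₀ ≤ N → ∃ P, IsForm P (k * n + N * m) ∧
      ∀ x, s.eval P x = l x ^ k * s.eval D x ^ N * t.eval F (φ x) := by
  unfold IsForm at hF
  induction hF using MvPolynomial.IsWeightedHomogeneous.induction_on with
  | zero => exact ⟨0, fun N _ => ⟨0, isForm_zero _, fun x => by simp⟩⟩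
  | add p q hp hq h₁ h₂ =>
    obtain ⟨N₁, h₁⟩ := h₁
    obtain ⟨N₂, h₂⟩ := h₂
    refine ⟨max N₁ N₂, fun N hN => ?_⟩
    obtain ⟨P, hP, eP⟩ := h₁ N (le_trans (le_max_left _ _) hN)
    obtain ⟨Q, hQ, eQ⟩ := h₂ N (le_trans (le_max_right _ _) hN)
    exact ⟨P + Q, isForm_add hP hQ, fun x => by simp [eP, eQ, mul_add]⟩
  | monomial d r hd =>
    obtain ⟨N₀, h⟩ := exists_pullback_monomial hH hG hD eH eG d
    refine ⟨N₀, fun N hN => ?_⟩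
    obtain ⟨P, hP, eP⟩ := h N hN
    refine ⟨MvPolynomial.C r * P, ?_, fun x => ?_⟩
    · rw [← hd]
      exact MvPolynomial.IsWeightedHomogeneous.C_mul hP r
    · have : MvPolynomial.monomial d r =
          (MvPolynomial.C r * MvPolynomial.monomial d 1 : MvPolynomial (A' ⊕ B') K) := by
        rw [MvPolynomial.C_mul_monomial, mul_one]
      rw [this, Coords.eval_mul, Coords.eval_mul, eP, ← hd, Coords.eval_C, Coords.eval_C]
      ring

end Pullback

/-- A form on the target pulls back, up to a nowhere vanishing factor, to a form on the source. The
factor does not affect zero loci, and it cancels from a quotient of two forms of equal degree once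
both use the same power of `D`. -/
theorem FormMap.isMorphism {s : Coords K X A B} {t : Coords K Y A' B'} {φ : X → Y}
    (h : FormMap s t φ) : IsMorphism s t φ := by
  obtain ⟨n, m, H, G, D, l, hH, hG, hD, hl, hD0, eH, eG⟩ := h
  constructor
  · rintro Z ⟨S, hS, rfl⟩
    -- The defining forms of the preimage are all forms which agree pointwise, up to nonzero
    -- scalars, with some `F ∈ S` along `φ`; `exists_pullback` ensures that every `F` is
    -- represented.
    refine ⟨{P | (∃ k, IsForm P k) ∧ ∃ F ∈ S, ∀ x, ∃ a : K, a ≠ 0 ∧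
      s.eval P x = a * t.eval F (φ x)}, fun P hP => hP.1, ?_⟩
    ext x
    constructor
    · rintro hx P ⟨-, F, hF, e⟩
      obtain ⟨a, -, e⟩ := e x
      rw [e, hx F hF, mul_zero]
    · intro hx F hF
      obtain ⟨k, hk⟩ := hS F hF
      obtain ⟨N, hN⟩ := exists_pullback hH hG hD eH eG hk
      obtain ⟨P, hP, eP⟩ := hN N le_rfl
      have h0 : ∀ x, l x ^ k * s.eval D x ^ N ≠ 0 := fun x =>
        mul_ne_zero (pow_ne_zero _ (hl x)) (pow_ne_zero _ (hD0 x))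
      have := hx P ⟨⟨_, hP⟩, F, hF, fun x => ⟨_, h0 x, eP x⟩⟩
      rw [eP] at this
      exact (mul_eq_zero.1 this).resolve_left (h0 x)
  · intro U f _ hf x hx
    obtain ⟨k, P, Q, hP, hQ, hQ0, e⟩ := hf (φ x) hx
    obtain ⟨N₁, h₁⟩ := exists_pullback hH hG hD eH eG hP
    obtain ⟨N₂, h₂⟩ := exists_pullback hH hG hD eH eG hQ
    obtain ⟨P', hP', eP⟩ := h₁ _ (le_max_left N₁ N₂)
    obtain ⟨Q', hQ', eQ⟩ := h₂ _ (le_max_right N₁ N₂)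
    have h0 : ∀ x, l x ^ k * s.eval D x ^ (max N₁ N₂) ≠ 0 := fun x =>
      mul_ne_zero (pow_ne_zero _ (hl x)) (pow_ne_zero _ (hD0 x))
    refine ⟨_, P', Q', hP', hQ', ?_, fun y hy hy0 => ?_⟩
    · rw [eQ]
      exact mul_ne_zero (h0 x) hQ0
    · rw [eQ] at hy0
      rw [eP, eQ, mul_div_mul_left _ _ (h0 y)]
      exact e (φ y) hy (right_ne_zero_of_mul hy0)

/-- The product of a map given by forms with an affine space. -/
theorem FormMap.prodAffine {s : Coords K X A B} {t : Coords K Y A' B'} {φ : X → Y}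
    (h : FormMap s t φ) (M : Type*) :
    FormMap (s.prodAffine M) (t.prodAffine M) (Prod.map φ (id : (M → K) → M → K)) := by
  obtain ⟨n, m, H, G, D, l, hH, hG, hD, hl, hD0, eH, eG⟩ := h
  let ρ : MvPolynomial (A ⊕ B) K →ₐ[K] MvPolynomial (A ⊕ (B ⊕ M)) K :=
    MvPolynomial.rename (Sum.map id Sum.inl)
  have hρ (P : MvPolynomial (A ⊕ B) K) (k : ℕ) (hP : IsForm P k) : IsForm (ρ P) k := by
    unfold IsForm at hP
    induction hP using MvPolynomial.IsWeightedHomogeneous.induction_on with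
    | zero => rw [map_zero]; exact isForm_zero _
    | add p q hp hq h₁ h₂ => rw [map_add]; exact isForm_add h₁ h₂
    | monomial d r hd =>
      simp only [ρ, MvPolynomial.rename_monomial]
      refine MvPolynomial.isWeightedHomogeneous_monomial _ _ _ ?_
      rw [← hd, Finsupp.weight_apply, Finsupp.weight_apply, Finsupp.sum_mapDomain_index]
      · refine Finsupp.sum_congr fun i _ => ?_
        rcases i with a | b <;> simp
      · simp
      · intro i a b; exact add_smul _ _ _
  have eρ (P : MvPolynomial (A ⊕ B) K) (x : X × (M → K)) :
      (s.prodAffine M).eval (ρ P) x = s.eval P x.1 := by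
    simp only [Coords.eval, ρ, MvPolynomial.eval_rename]
    congr 2
    ext i
    rcases i with a | b <;> simp [Coords.prodAffine]
  -- The coordinates of the affine factor have no denominator of their own; multiplying them by `D`
  -- gives them the common one.
  refine ⟨n, m, fun a => ρ (H a), Sum.elim (fun b => ρ (G b))
    (fun i => ρ D * MvPolynomial.X (.inr (.inr i))), ρ D, fun x => l x.1, fun a => hρ _ _ (hH a),
    ?_, hρ _ _ hD, fun x => hl x.1, fun x => ?_, fun x a => ?_, fun x b => ?_⟩
  · rintro (b | i)
    · exact hρ _ _ (hG b)
    · exact isForm_mul (hρ _ _ hD) (MvPolynomial.isWeightedHomogeneous_X K _ _)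
  · rw [eρ]; exact hD0 x.1
  · rw [eρ, eH]; rfl
  · rcases b with b | i
    · rw [Sum.elim_inl, eρ, eρ, eG]; rfl
    · rw [Sum.elim_inr, Coords.eval_mul, eρ, Coords.eval_X_inr]; rfl

/-- A map to an affine space whose coordinates are some of the affine coordinates. -/
theorem FormMap.of_reindex [IsEmpty A'] {s : Coords K X A B} {t : Coords K Y A' B'} {φ : X → Y}
    (g : B' → B) (h : ∀ x b, t.aff (φ x) b = s.aff x (g b)) : FormMap s t φ :=
  ⟨0, 0, fun _ => 0, fun b => MvPolynomial.X (.inr (g b)), 1, fun _ => 1, fun a => isEmptyElim a,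
    fun b => MvPolynomial.isWeightedHomogeneous_X K _ (Sum.inr (g b)), isForm_one,
    fun _ => one_ne_zero, fun x => by simp, fun _ a => isEmptyElim a, fun x b => by simp [h]⟩

/-- Every map on an empty set is given by forms. -/
theorem FormMap.of_isEmpty [IsEmpty X] (s : Coords K X A B) (t : Coords K Y A' B') (φ : X → Y) :
    FormMap s t φ :=
  ⟨0, 0, fun _ => 0, fun _ => 0, 0, fun _ => 1, fun _ => isForm_zero _, fun _ => isForm_zero _,
    isForm_zero _, fun x => isEmptyElim x, fun x => isEmptyElim x, fun x => isEmptyElim x,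
    fun x => isEmptyElim x⟩

theorem IsMorphism.comp {s : Coords K X A B} {t : Coords K Y A' B'} {r : Coords K Z A'' B''}
    {φ : X → Y} {ψ : Y → Z} (hψ : IsMorphism t r ψ) (hφ : IsMorphism s t φ) :
    IsMorphism s r (ψ ∘ φ) :=
  ⟨fun W hW => hφ.continuous _ (hψ.continuous W hW), fun U f hU hf =>
    hφ.regular _ _ (hψ.continuous _ hU) (hψ.regular U f hU hf)⟩

/-- The inverse of an isomorphism. -/
def Iso.symm {s : Coords K X A B} {t : Coords K Y A' B'} (F : Iso s t) : Iso t s :=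
  ⟨F.toEquiv.symm, F.isMorphism_symm, F.isMorphism⟩

/-- The composition of isomorphisms. -/
def Iso.trans {s : Coords K X A B} {t : Coords K Y A' B'} {r : Coords K Z A'' B''}
    (F : Iso s t) (F' : Iso t r) : Iso s r :=
  ⟨F.toEquiv.trans F'.toEquiv, F'.isMorphism.comp F.isMorphism,
    F.isMorphism_symm.comp F'.isMorphism_symm⟩

/-- A bijection which is given by forms in both directions. -/
def Iso.ofFormMap {s : Coords K X A B} {t : Coords K Y A' B'} (f : X ≃ Y) (h : FormMap s t f)
    (h' : FormMap t s f.symm) : Iso s t :=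
  ⟨f, h.isMorphism, h'.isMorphism⟩

/-- Closed subsets of affine space are the zero loci of polynomials. -/
theorem isClosed_affineSpace (S : Set (MvPolynomial M K)) :
    (affineSpace K M).IsClosed {c | ∀ f ∈ S, MvPolynomial.eval c f = 0} := by
  refine ⟨MvPolynomial.rename Sum.inr '' S, ?_, ?_⟩
  · rintro _ ⟨f, -, rfl⟩
    exact ⟨0, isForm_rename_inr f⟩
  · ext c
    simp only [Set.mem_ofPred_eq, Set.forall_mem_image, Coords.eval_rename_inr]
    rfl

/-! ### Functions on affine space given by polynomials over a smaller field. -/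

section PolyFun

variable (F : Type*) [Field F] [Algebra F K]

/-- The functions on `K^M` that are given by polynomials with coefficients in `F`. -/
noncomputable def polyFun (K : Type u) [Field K] [Algebra F K] (M : Type*) :
    Subalgebra F ((M → K) → K) :=
  (MvPolynomial.aeval fun (i : M) (c : M → K) => c i).range

variable {F}

theorem mem_polyFun {g : (M → K) → K} :
    g ∈ polyFun F K M ↔ ∃ P : MvPolynomial M F, ∀ c, MvPolynomial.aeval c P = g c := by
  have key (P : MvPolynomial M F) (c : M → K) :
      MvPolynomial.aeval (fun (i : M) (c : M → K) => c i) P c = MvPolynomial.aeval c P := by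
    induction P using MvPolynomial.induction_on with
    | C a => simp
    | add p q hp hq => simp [hp, hq]
    | mul_X p b hp => simp [hp]
  constructor
  · rintro ⟨P, rfl⟩
    exact ⟨P, fun c => (key P c).symm⟩
  · rintro ⟨P, hP⟩
    exact ⟨P, funext fun c => (key P c).trans (hP c)⟩

theorem coord_mem_polyFun (i : M) : (fun c : M → K => c i) ∈ polyFun F K M :=
  mem_polyFun.2 ⟨MvPolynomial.X i, fun c => by simp⟩

theorem const_mem_polyFun (a : F) : (fun _ : M → K => algebraMap F K a) ∈ polyFun F K M :=
  mem_polyFun.2 ⟨MvPolynomial.C a, fun c => by simp⟩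

theorem mul_mem_polyFun {g h : (M → K) → K} (hg : g ∈ polyFun F K M) (hh : h ∈ polyFun F K M) :
    (fun c => g c * h c) ∈ polyFun F K M :=
  mul_mem hg hh

theorem sum_mem_polyFun {κ : Type*} (s : Finset κ) {g : κ → (M → K) → K}
    (hg : ∀ i ∈ s, g i ∈ polyFun F K M) : (fun c => ∑ i ∈ s, g i c) ∈ polyFun F K M := by
  have := sum_mem hg
  convert this using 1
  ext c
  simp

theorem prod_mem_polyFun {κ : Type*} (s : Finset κ) {g : κ → (M → K) → K}
    (hg : ∀ i ∈ s, g i ∈ polyFun F K M) : (fun c => ∏ i ∈ s, g i c) ∈ polyFun F K M := by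
  have := prod_mem hg
  convert this using 1
  ext c
  simp

/-- The zero locus of a family of functions given by polynomials over `F` in finitely many variables
is the zero locus of finitely many polynomials over `F`. -/
theorem exists_finset_zeroLocus [Finite M] {κ : Type*} {g : κ → (M → K) → K}
    (hg : ∀ i, g i ∈ polyFun F K M) :
    ∃ S : Finset (MvPolynomial M F),
      {c | ∀ i, g i c = 0} = {c | ∀ f ∈ S, MvPolynomial.aeval c f = 0} := by
  choose P hP using fun i => mem_polyFun.1 (hg i)
  -- Hilbert's basis theorem; a zero locus depends only on the ideal generated by its equations.
  obtain ⟨S, hS⟩ := IsNoetherian.noetherian (Ideal.span (Set.range P))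
  refine ⟨S, ?_⟩
  have key (T : Set (MvPolynomial M F)) (c : M → K) :
      (∀ f ∈ T, MvPolynomial.aeval c f = 0) ↔
        ∀ f ∈ Ideal.span T, MvPolynomial.aeval c f = 0 := by
    refine ⟨fun h f hf => ?_, fun h f hf => h f (Ideal.subset_span hf)⟩
    have : Ideal.span T ≤ RingHom.ker (MvPolynomial.aeval c : MvPolynomial M F →ₐ[F] K) :=
      Ideal.span_le.2 h
    exact this hf
  ext c
  have h₁ := key (S : Set _) c
  have h₂ := key (Set.range P) c
  rw [show Ideal.span (S : Set (MvPolynomial M F)) = Ideal.span (Set.range P) from hS, ← h₂] at h₁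
  simp only [Finset.mem_coe] at h₁
  rw [Set.mem_ofPred_eq, Set.mem_ofPred_eq, h₁, Set.forall_mem_range]
  simp only [hP]

end PolyFun

/-- The zero locus of a family of functions given by polynomials is closed. -/
theorem isClosed_zeroLocus {κ : Type*} {g : κ → (M → K) → K} (hg : ∀ i, g i ∈ polyFun K K M) :
    (affineSpace K M).IsClosed {c | ∀ i, g i c = 0} := by
  choose P hP using fun i => mem_polyFun.1 (hg i)
  convert isClosed_affineSpace (Set.range P) using 1
  ext c
  simp only [Set.mem_ofPred_eq, Set.forall_mem_range, ← hP]
  rfl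

/-- A closed subset of an affine space of finite dimension is an affine variety. -/
theorem isAffineVariety_of_iso [Finite M] {s : Coords K X A B} {Z : Set (M → K)}
    (hZ : (affineSpace K M).IsClosed Z) (F : Iso s (affineSubset Z)) : IsAffineVariety s := by
  obtain ⟨n, ⟨f⟩⟩ := Finite.exists_equiv_fin M
  let g : (Fin n → K) ≃ (M → K) := Equiv.arrowCongr f.symm (Equiv.refl K)
  have h : FormMap (affineSpace K (Fin n)) (affineSpace K M) g :=
    have : IsEmpty Empty := inferInstance
    FormMap.of_reindex f fun x b => by simp [affineSpace, g]
  refine ⟨n, g ⁻¹' Z, h.isMorphism.continuous Z hZ, ⟨F.trans (Iso.ofFormMap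
    ((g.subtypeEquiv fun _ => Iff.rfl).symm) ?_ ?_)⟩⟩
  · refine FormMap.of_reindex f.symm fun x b => ?_
    simp [affineSubset, affineSpace, Coords.comap, g]
  · refine FormMap.of_reindex f fun x b => ?_
    simp [affineSubset, affineSpace, Coords.comap, g]

end QP

/-! ### The path length filtration of the bound path algebra and its radical. -/

namespace BoundQuiver

section

variable {K : Type u} [Field K] {V : Type v} [Quiver.{w + 1} V]

namespace PathAlgebra

theorem coeff_of (p q : AnyPath V) [Decidable (q = p)] :
    (of K p).coeff q = if q = p then 1 else 0 := by
  classical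
  simp [coeff, of, Finsupp.single_apply, eq_comm]

/-- The coefficient of a path, as a linear map. -/
noncomputable def coeffLin (p : AnyPath V) : PathAlgebra K V →ₗ[K] K := Finsupp.lapply p

theorem coeffLin_apply (x : PathAlgebra K V) (p : AnyPath V) : coeffLin p x = x.coeff p := rfl

theorem eq_sum_coeff (x : PathAlgebra K V) :
    ∃ s : Finset (AnyPath V), x = ∑ p ∈ s, x.coeff p • of K p := by
  classical
  refine ⟨Finsupp.support (show AnyPath V →₀ K from x), ?_⟩
  have h := (Finsupp.sum_single (show AnyPath V →₀ K from x)).symm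
  refine h.trans ?_
  refine Finset.sum_congr rfl fun p _ => ?_
  have e : x.coeff p • of K p = Finsupp.single p (x.coeff p) := by
    refine (Finsupp.smul_single (x.coeff p) p (1 : K)).trans ?_
    simp
  exact e.symm

end PathAlgebra

theorem AnyPath.nil_ne {p : AnyPath V} (h : p.path.length ≠ 0) (i : V) :
    (⟨i, i, .nil⟩ : AnyPath V) ≠ p := by
  rintro rfl
  exact h rfl

theorem AnyPath.eq_nil_of_length {p : AnyPath V} (h : p.path.length = 0) :
    p = ⟨p.src, p.src, .nil⟩ := by
  obtain ⟨a, b, p⟩ := p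
  cases p with
  | nil => rfl
  | cons p e => simp at h

namespace PathAlgebra

variable [Fintype V]

theorem of_comp {a b c : V} (p : Quiver.Path a b) (q : Quiver.Path b c) :
    of K (⟨a, c, p.comp q⟩ : AnyPath V) = of K ⟨b, c, q⟩ * of K ⟨a, b, p⟩ := by
  rw [of_mul_of, pathMul, dif_pos rfl]
  rfl

theorem of_mul_of_ne {p q : AnyPath V} (h : p.src ≠ q.tgt) : of K p * of K q = 0 := by
  rw [of_mul_of, pathMul, dif_neg h]

/-- A concatenation has length zero only if both factors do, so reading off a trivial coefficient is
multiplicative. The resulting ring homomorphism to `K` detects elements outside the radical. -/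
theorem coeff_nil_mul (x y : PathAlgebra K V) (i : V) :
    (x * y).coeff ⟨i, i, .nil⟩ = x.coeff ⟨i, i, .nil⟩ * y.coeff ⟨i, i, .nil⟩ := by
  classical
  simp only [← coeffLin_apply]
  induction x using induction_on with
  | zero => simp
  | add x x' hx hx' => simp only [add_mul, map_add, hx, hx']
  | smul_of a p =>
    induction y using induction_on with
    | zero => simp
    | add y y' hy hy' => simp only [mul_add, map_add, hy, hy']
    | smul_of b q =>
      simp only [smul_mul', mul_smul', map_smul, smul_eq_mul]
      suffices coeffLin ⟨i, i, .nil⟩ (of K p * of K q) =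
          coeffLin ⟨i, i, .nil⟩ (of K p) * coeffLin ⟨i, i, .nil⟩ (of K q) by rw [this]; ring
      by_cases h : p.src = q.tgt
      · obtain ⟨b, c, p⟩ := p
        obtain ⟨a, b', q⟩ := q
        obtain rfl : b = b' := h
        rw [← of_comp]
        simp only [coeffLin_apply, coeff_of]
        cases p with
        | cons p e =>
          rw [if_neg (AnyPath.nil_ne (by simp) i), if_neg (AnyPath.nil_ne (by simp) i), zero_mul]
        | nil =>
          cases q with
          | cons q e =>
            rw [if_neg (AnyPath.nil_ne (by simp) i),
              if_neg (c := _ = (⟨a, _, q.cons e⟩ : AnyPath V)) (AnyPath.nil_ne (by simp) i),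
              mul_zero]
          | nil => simp
      · rw [of_mul_of_ne h, map_zero]
        simp only [coeffLin_apply, coeff_of]
        by_cases h₁ : (⟨i, i, .nil⟩ : AnyPath V) = p
        · subst h₁
          rw [if_neg (c := _ = q), mul_zero]
          rintro rfl
          exact h rfl
        · rw [if_neg h₁, zero_mul]

/-- The coefficient of the path of length zero at a vertex, as a homomorphism of rings. -/
noncomputable def coeffNil (i : V) : PathAlgebra K V →+* K where
  toFun x := x.coeff ⟨i, i, .nil⟩
  map_one' := by
    classical
    rw [← coeffLin_apply, one_def, map_sum, Finset.sum_eq_single i]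
    · simp [coeffLin_apply, coeff_of]
    · intro j _ hj
      rw [coeffLin_apply, coeff_of, if_neg]
      simp [hj.symm]
    · simp
  map_mul' x y := coeff_nil_mul x y i
  map_zero' := map_zero (coeffLin ⟨i, i, .nil⟩)
  map_add' := map_add (coeffLin ⟨i, i, .nil⟩)

end PathAlgebra

variable [Fintype V] (I : Ideal (PathAlgebra K V)) [I.IsTwoSided]

theorem pathClass_comp {a b c : V} (p : Quiver.Path a b) (q : Quiver.Path b c) :
    pathClass I ⟨a, c, p.comp q⟩ = pathClass I ⟨b, c, q⟩ * pathClass I ⟨a, b, p⟩ := by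
  rw [pathClass, PathAlgebra.of_comp, map_mul]
  rfl

theorem pathClass_mul_of_ne {p q : AnyPath V} (h : p.src ≠ q.tgt) :
    pathClass I p * pathClass I q = 0 := by
  rw [pathClass, pathClass, ← map_mul, PathAlgebra.of_mul_of_ne h, map_zero]

theorem vtx_mul_pathClass {a b : V} (p : Quiver.Path a b) :
    vtx I b * pathClass I ⟨a, b, p⟩ = pathClass I ⟨a, b, p⟩ := by
  rw [vtx, ← pathClass_comp, Quiver.Path.comp_nil]

theorem mk_smul (a : K) (x : PathAlgebra K V) :
    Ideal.Quotient.mk I (a • x) = a • Ideal.Quotient.mk I x := rfl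

/-- The span of the residue classes of the paths of length at least `l`. -/
noncomputable def pathSpan (l : ℕ) : Submodule K (PathAlgebra K V ⧸ I) :=
  Submodule.span K {x | ∃ p : AnyPath V, l ≤ p.path.length ∧ x = pathClass I p}

theorem pathClass_mem_pathSpan {p : AnyPath V} {l : ℕ} (h : l ≤ p.path.length) :
    pathClass I p ∈ pathSpan I l :=
  Submodule.subset_span ⟨p, h, rfl⟩

theorem mk_mem_pathSpan {x : PathAlgebra K V} {l : ℕ}
    (h : ∀ p, x.coeff p ≠ 0 → l ≤ p.path.length) : Ideal.Quotient.mk I x ∈ pathSpan I l := by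
  obtain ⟨s, hs⟩ := x.eq_sum_coeff
  rw [hs, map_sum]
  refine Submodule.sum_mem _ fun p _ => ?_
  by_cases hp : x.coeff p = 0
  · rw [hp, zero_smul, map_zero]; exact Submodule.zero_mem _
  · exact Submodule.smul_mem _ _ (pathClass_mem_pathSpan I (h p hp))

theorem pathSpan_zero : pathSpan I 0 = ⊤ := by
  rw [eq_top_iff]
  rintro x -
  obtain ⟨x, rfl⟩ := Ideal.Quotient.mk_surjective x
  exact mk_mem_pathSpan I fun _ _ => Nat.zero_le _

/-- Composable paths concatenate and all other products vanish; conversely a path of length at least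
`k + l` can be cut after its first `l` arrows. -/
theorem pathSpan_mul (k l : ℕ) : pathSpan I k * pathSpan I l = pathSpan I (k + l) := by
  rw [pathSpan, pathSpan, Submodule.span_mul_span]
  apply le_antisymm
  · rw [Submodule.span_le]
    rintro _ ⟨_, ⟨p, hp, rfl⟩, _, ⟨q, hq, rfl⟩, rfl⟩
    by_cases h : p.src = q.tgt
    · obtain ⟨b, c, p⟩ := p
      obtain ⟨a, b', q⟩ := q
      obtain rfl : b = b' := h
      simp only [← pathClass_comp]
      refine pathClass_mem_pathSpan I ?_
      simp only [Quiver.Path.length_comp] at *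
      omega
    · simp only [pathClass_mul_of_ne I h]
      exact Submodule.zero_mem _
  · refine Submodule.span_le.2 ?_
    rintro _ ⟨⟨a, c, p⟩, hp, rfl⟩
    obtain ⟨b, p₁, p₂, rfl, h⟩ := p.exists_eq_comp_of_le_length (n := l) (by simp at hp; omega)
    refine Submodule.subset_span ⟨pathClass I ⟨b, c, p₂⟩, ⟨_, ?_, rfl⟩, pathClass I ⟨a, b, p₁⟩,
      ⟨_, h.ge, rfl⟩, (pathClass_comp I p₁ p₂).symm⟩
    simp only [Quiver.Path.length_comp] at *
    omega

/-- Exponent zero is excluded: the zeroth power of a `K`-subspace is only the line spanned by `1`,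
while the paths of length at least zero span the whole algebra. -/
theorem pathSpan_one_pow (l : ℕ) (hl : l ≠ 0) : pathSpan I 1 ^ l = pathSpan I l := by
  induction l with
  | zero => exact absurd rfl hl
  | succ l ih =>
    rcases Nat.eq_zero_or_pos l with rfl | h
    · simp
    · rw [pow_succ, ih h.ne', pathSpan_mul]

theorem pathSpan_antitone {k l : ℕ} (h : k ≤ l) : pathSpan I l ≤ pathSpan I k := by
  refine Submodule.span_mono ?_
  rintro _ ⟨p, hp, rfl⟩
  exact ⟨p, h.trans hp, rfl⟩

variable [IsAdmissible I]

theorem exists_pathSpan_eq_bot : ∃ l, pathSpan I (l + 1) = ⊥ := by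
  obtain ⟨l, hl⟩ := IsAdmissible.exists_mem (I := I)
  refine ⟨l, ?_⟩
  rw [pathSpan, Submodule.span_eq_bot]
  rintro _ ⟨p, hp, rfl⟩
  exact Ideal.Quotient.eq_zero_iff_mem.2 (hl p (by omega))

/-- The Jacobson radical is generated by the residue classes of the arrows. -/
theorem restrictScalars_rad : (rad I).restrictScalars K = pathSpan I 1 := by
  apply le_antisymm
  · intro x hx
    obtain ⟨x, rfl⟩ := Ideal.Quotient.mk_surjective x
    refine mk_mem_pathSpan I fun p hp => ?_
    by_contra h
    rw [AnyPath.eq_nil_of_length (show p.path.length = 0 by omega)] at hp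
    refine hp ?_
    -- The trivial coefficient descends to `Λ` because elements of `I` involve only paths of length
    -- at least two. It is a surjection onto a field, so it sends the radical to zero.
    let f : PathAlgebra K V ⧸ I →+* K := Ideal.Quotient.lift I (PathAlgebra.coeffNil p.src) (by
      intro y hy
      by_contra h0
      exact absurd (IsAdmissible.two_le_length y hy _ h0) (by simp))
    have hf : Function.Surjective f := fun a => by
      refine ⟨a • 1, ?_⟩
      have : f (a • 1) = a * f 1 := rfl
      rw [this, map_one, mul_one]
    have : RingHomSurjective f := ⟨hf⟩
    have h1 := Ring.le_comap_jacobson f hx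
    rw [Ring.jacobson_eq_sInf_isMaximal] at h1
    have h2 := (Submodule.mem_sInf.1 h1) ⊥ Ideal.bot_isMaximal
    exact h2
  · intro x hx
    change x ∈ rad I
    rw [rad, ← Ideal.jacobson_bot, Ideal.mem_jacobson_iff]
    intro y
    have hyx : y * x ∈ pathSpan I 1 := by
      have := Submodule.mul_mem_mul (show y ∈ pathSpan I 0 by rw [pathSpan_zero]; trivial) hx
      rwa [pathSpan_mul, zero_add] at this
    -- The span of the paths of positive length absorbs left multiplication and is nilpotent, so `1
    -- + y x` is a unit; its inverse is the witness for quasi-regularity.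
    have hnil : IsNilpotent (y * x) := by
      obtain ⟨l, hl⟩ := exists_pathSpan_eq_bot I
      refine ⟨l + 1, ?_⟩
      have := Submodule.pow_mem_pow _ hyx (l + 1)
      rwa [pathSpan_one_pow I _ l.succ_ne_zero, hl, Submodule.mem_bot] at this
    obtain ⟨a, ha⟩ := hnil.isUnit_one_add
    refine ⟨(a⁻¹ : (PathAlgebra K V ⧸ I)ˣ), ?_⟩
    have := a.inv_mul
    rw [ha, mul_add, mul_one] at this
    rw [Ideal.mem_bot, sub_eq_zero, ← this, mul_assoc, add_comm]

theorem restrictScalars_rad_pow (l : ℕ) : (rad I ^ l).restrictScalars K = pathSpan I l := by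
  rcases Nat.eq_zero_or_pos l with rfl | h
  · rw [pathSpan_zero, Submodule.pow_zero, Ideal.one_eq_top]
    rfl
  · rw [Submodule.restrictScalars_pow h.ne', restrictScalars_rad, pathSpan_one_pow I _ h.ne']

/-- Admissibility makes the radical nilpotent, so the infimum defining `loewy` is attained and is
not a default value. -/
theorem pathSpan_loewy : pathSpan I (loewy I + 1) = ⊥ := by
  have hne : {l : ℕ | rad I ^ (l + 1) = ⊥}.Nonempty := by
    obtain ⟨l, hl⟩ := exists_pathSpan_eq_bot I
    refine ⟨l, ?_⟩
    rw [← restrictScalars_rad_pow] at hl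
    exact (Submodule.restrictScalars_eq_bot_iff K _ _).1 hl
  have := Nat.sInf_mem hne
  rw [← restrictScalars_rad_pow]
  exact (Submodule.restrictScalars_eq_bot_iff K _ _).2 this

theorem pathClass_eq_zero {p : AnyPath V} (h : loewy I < p.path.length) : pathClass I p = 0 := by
  have := pathClass_mem_pathSpan I (l := loewy I + 1) (p := p) h
  rwa [pathSpan_loewy, Submodule.mem_bot] at this

section

variable (M : Type*) [AddCommGroup M] [Module (PathAlgebra K V ⧸ I) M]

theorem radPow_zero : radPow I M 0 = ⊤ := by
  rw [radPow, Submodule.pow_zero, Ideal.one_eq_top, Submodule.top_smul]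

theorem radPow_of_loewy_lt {l : ℕ} (h : loewy I < l) : radPow I M l = ⊥ := by
  have : rad I ^ l = ⊥ := by
    rw [← Submodule.restrictScalars_eq_bot_iff (S := K), restrictScalars_rad_pow, eq_bot_iff,
      ← pathSpan_loewy I]
    exact pathSpan_antitone I h
  rw [radPow, this, Submodule.bot_smul]

variable {M}

theorem pathClass_smul_mem_radPow {p : AnyPath V} {l : ℕ} (h : l ≤ p.path.length) (x : M) :
    pathClass I p • x ∈ radPow I M l := by
  refine Submodule.smul_mem_smul ?_ trivial
  have := pathClass_mem_pathSpan I h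
  rw [← restrictScalars_rad_pow] at this
  exact this

variable (M) [Module K M] [IsScalarTower K (PathAlgebra K V ⧸ I) M]

/-- Since `J^l` is `K`-spanned by classes of paths of length at least `l`, testing paths is enough,
and `W` need only be a `K`-subspace. -/
theorem restrictScalars_radPow_le {l : ℕ} {W : Submodule K M}
    (h : ∀ p : AnyPath V, l ≤ p.path.length → ∀ x : M, pathClass I p • x ∈ W) :
    (radPow I M l).restrictScalars K ≤ W := by
  intro x hx
  refine Submodule.smul_induction_on (p := fun x => x ∈ W) (show x ∈ rad I ^ l • ⊤ from hx)
    (fun r hr n _ => ?_) fun x y hx hy => add_mem hx hy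
  have hr' : r ∈ pathSpan I l := by rw [← restrictScalars_rad_pow]; exact hr
  have h' : pathSpan I l ≤ W.comap ((LinearMap.toSpanSingleton (PathAlgebra K V ⧸ I) M
      n).restrictScalars K) := by
    refine Submodule.span_le.2 ?_
    rintro _ ⟨p, hp, rfl⟩
    exact h p hp n
  exact h' hr'

end

end

end BoundQuiver

/-! ### Critical paths and the rewriting coefficients they prescribe. -/

namespace BoundQuiver

section

variable {K : Type u} [Field K] {V : Type v} [Quiver.{w + 1} V]
variable {ι : Type z} {e : ι → V}

namespace TopPath

/-- The path obtained from `y` by adding an arrow. -/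
def extend (y : TopPath e) {j : V} (a : y.tgt ⟶ j) : TopPath e := ⟨y.root, j, y.path.cons a⟩

theorem length_extend (y : TopPath e) {j : V} (a : y.tgt ⟶ j) :
    (y.extend a).length = y.length + 1 := rfl

theorem isInitial_extend {x y : TopPath e} {j : V} {a : y.tgt ⟶ j} (h : x.IsInitial (y.extend a))
    (hne : x ≠ y.extend a) : x.IsInitial y := by
  obtain ⟨r, i, p⟩ := x
  obtain ⟨s, k, q⟩ := y
  obtain ⟨t, ht⟩ := h
  simp only [extend, TopPath.mk.injEq, true_and] at ht t hne
  obtain ⟨rfl, ht⟩ := ht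
  rw [heq_iff_eq] at ht
  cases t with
  | nil =>
    simp only [Quiver.Path.comp_nil] at ht
    subst ht
    simp at hne
  | cons t b =>
    rw [Quiver.Path.comp_cons] at ht
    obtain rfl := Quiver.Path.obj_eq_of_cons_eq_cons ht
    exact ⟨t, by rw [eq_of_heq (Quiver.Path.heq_of_cons_eq_cons ht)]⟩

theorem eq_top_of_isInitial {x : TopPath e} {r : ι} (h : x.IsInitial (top e r)) : x = top e r := by
  obtain ⟨s, i, p⟩ := x
  obtain ⟨t, ht⟩ := h
  simp only [top, TopPath.mk.injEq] at ht t
  obtain ⟨rfl, -, ht⟩ := ht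
  have h := congrArg Quiver.Path.length (eq_of_heq ht)
  rw [Quiver.Path.length_nil, Quiver.Path.length_comp] at h
  cases p with
  | nil => rfl
  | cons p a =>
    rw [Quiver.Path.length_cons] at h
    omega

theorem top_isInitial (y : TopPath e) : (top e y.root).IsInitial y :=
  ⟨y.path, by simp [top]⟩

theorem IsInitial.length_le {x y : TopPath e} (h : x.IsInitial y) : x.length ≤ y.length := by
  obtain ⟨t, ht⟩ := h
  rw [ht, length, length, Quiver.Path.length_comp]
  exact Nat.le_add_right _ _

theorem IsInitial.extend {x y : TopPath e} (h : x.IsInitial y) {j : V} (a : y.tgt ⟶ j) :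
    x.IsInitial (y.extend a) := by
  obtain ⟨s, k, p⟩ := y
  obtain ⟨t, ht⟩ := h
  obtain ⟨r, i, q⟩ := x
  simp only [TopPath.mk.injEq, true_and] at ht t
  obtain ⟨rfl, ht⟩ := ht
  obtain rfl := eq_of_heq ht
  exact ⟨t.cons a, rfl⟩

theorem isInitial_extend_self (y : TopPath e) {j : V} (a : y.tgt ⟶ j) :
    y.IsInitial (y.extend a) := ⟨Quiver.Hom.toPath a, rfl⟩

end TopPath

variable [Fintype V] (I : Ideal (PathAlgebra K V)) [I.IsTwoSided]

/-- A set of paths of length at most `L` that is closed under initial subpaths. -/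
structure IsPathSet (σ : Finset (TopPath e)) : Prop where
  length_le : ∀ y ∈ σ, y.length ≤ loewy I
  initial_mem : ∀ x y : TopPath e, x.IsInitial y → y ∈ σ → x ∈ σ

/-- The path `y` is `σ`-critical. -/
def IsCritical (σ : Finset (TopPath e)) (y : TopPath e) : Prop :=
  y ∉ σ ∧ y.length ≤ loewy I ∧ ∀ x : TopPath e, x.IsInitial y → x ≠ y → x ∈ σ

/-- The path `y` is in `σ`, or it is critical, or it is too long for not being zero. -/
def IsReducible (σ : Finset (TopPath e)) (y : TopPath e) : Prop :=
  y ∈ σ ∨ IsCritical I σ y ∨ loewy I < y.length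

/-- A path of length zero has no proper initial subpath, so it is critical as soon as it is missing
from `σ`. These paths are the source of `N₀`. -/
theorem isReducible_top (σ : Finset (TopPath e)) (r : ι) : IsReducible I σ (TopPath.top e r) := by
  by_cases h : TopPath.top e r ∈ σ
  · exact .inl h
  · exact .inr (.inl ⟨h, Nat.zero_le _, fun x hx hne =>
      absurd (TopPath.eq_top_of_isInitial hx) hne⟩)

variable {I} {σ : Finset (TopPath e)}

/-- All proper initial subpaths of the extension are initial subpaths of `y`, hence in `σ`. This
trichotomy is what makes the relations of the critical paths sufficient for rewriting every path. -/
theorem IsPathSet.isReducible_extend (hσ : IsPathSet I σ) {y : TopPath e} (hy : y ∈ σ) {j : V}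
    (a : y.tgt ⟶ j) : IsReducible I σ (y.extend a) := by
  by_cases h : y.extend a ∈ σ
  · exact .inl h
  by_cases h' : loewy I < (y.extend a).length
  · exact .inr (.inr h')
  · exact .inr (.inl ⟨h, not_lt.1 h', fun x hx hne =>
      hσ.initial_mem _ _ (TopPath.isInitial_extend hx hne) hy⟩)

theorem mem_sigmaSet {y q : TopPath e} :
    q ∈ sigmaSet σ y ↔ q ∈ σ ∧ y.length ≤ q.length ∧ q.tgt = y.tgt := by
  classical
  simp [sigmaSet]

open Classical in
/-- The coefficients of a path, with respect to the paths in `σ`, which are prescribed by the family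
`c` of coefficients of the critical paths. -/
noncomputable def red (c : IndexN I σ → K) (y : TopPath e) (q : TopPath e) : K :=
  if y ∈ σ then if q = y then 1 else 0
  else if h : IsCritical I σ y ∧ q ∈ sigmaSet σ y then c ⟨⟨y, h.1⟩, ⟨q, h.2⟩⟩ else 0

theorem red_eq_zero (c : IndexN I σ → K) {y q : TopPath e}
    (h : ¬ (y.length ≤ q.length ∧ q.tgt = y.tgt)) : red c y q = 0 := by
  unfold red
  split_ifs with h₁ h₂ h₃
  · subst h₂
    exact absurd ⟨le_rfl, rfl⟩ h
  · rfl
  · exact absurd (mem_sigmaSet.1 h₃.2).2 h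
  · rfl

theorem red_crit (c : IndexN I σ → K) (y : CritPath I σ) (q : ↥(sigmaSet σ y.1)) :
    red c y.1 q.1 = c ⟨y, q⟩ := by
  rw [red, if_neg y.2.1, dif_pos ⟨y.2, q.2⟩]

theorem red_self (c : IndexN I σ → K) {y : TopPath e} (hy : y ∈ σ) (q : TopPath e)
    [Decidable (q = y)] : red c y q = if q = y then 1 else 0 := by
  rw [red, if_pos hy]
  congr

theorem red_of_loewy_lt (c : IndexN I σ → K) {y : TopPath e} (hσ : IsPathSet I σ)
    (h : loewy I < y.length) (q : TopPath e) : red c y q = 0 := by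
  rw [red, if_neg fun hy => absurd (hσ.length_le y hy) (not_le.2 h), dif_neg]
  exact fun h' => absurd h'.1.2.1 (not_le.2 h)

/-! ### Modules whose top elements satisfy the relations; criteria for skeleta. -/

section Module

variable {M : Type*} [AddCommGroup M] [Module (PathAlgebra K V ⧸ I) M]

theorem vtx_smul_act (y : TopPath e) (x : ι → M) : vtx I y.tgt • y.act I x = y.act I x := by
  rw [TopPath.act, ← mul_smul, vtx_mul_pathClass]

theorem pathClass_smul_act_of_ne {p : AnyPath V} {y : TopPath e} (h : p.src ≠ y.tgt) (x : ι → M) :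
    pathClass I p • y.act I x = 0 := by
  rw [TopPath.act, ← mul_smul, pathClass_mul_of_ne I (by exact h), zero_smul]

theorem act_extend (y : TopPath e) {j : V} (a : y.tgt ⟶ j) (x : ι → M) :
    (y.extend a).act I x = pathClass I ⟨_, _, Quiver.Hom.toPath a⟩ • y.act I x := by
  rw [TopPath.act, TopPath.act, ← mul_smul, ← pathClass_comp]
  rfl

theorem act_top {x : ι → M} {r : ι} (hr : vtx I (e r) • x r = x r) :
    (TopPath.top e r).act I x = x r := hr

variable [Module K M] [IsScalarTower K (PathAlgebra K V ⧸ I) M]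

/-- The elements `x r` of `M` satisfy the relations that belong to the family `c`. -/
def IsRelated (c : IndexN I σ → K) (x : ι → M) : Prop :=
  ∀ y : CritPath I σ, y.1.act I x = ∑ q : ↥(sigmaSet σ y.1), c ⟨y, q⟩ • q.1.act I x

theorem sum_sigmaSet (c : IndexN I σ → K) (x : ι → M) (y : CritPath I σ) :
    ∑ q : ↥(sigmaSet σ y.1), c ⟨y, q⟩ • q.1.act I x = ∑ q ∈ σ, red c y.1 q • q.act I x := by
  have : sigmaSet σ y.1 ⊆ σ := fun q hq => (mem_sigmaSet.1 hq).1
  rw [← Finset.sum_subset this, ← Finset.sum_coe_sort (sigmaSet σ y.1)]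
  · exact Finset.sum_congr rfl fun q _ => by rw [red_crit]
  · intro q hq hq'
    rw [red_eq_zero c, zero_smul]
    exact fun h => hq' (mem_sigmaSet.2 ⟨hq, h⟩)

theorem IsRelated.act_eq [IsAdmissible I] (hσ : IsPathSet I σ) {c : IndexN I σ → K} {x : ι → M}
    (h : IsRelated c x) {y : TopPath e} (hy : IsReducible I σ y) :
    y.act I x = ∑ q ∈ σ, red c y q • q.act I x := by
  classical
  rcases hy with hy | hy | hy
  · rw [Finset.sum_eq_single y]
    · rw [red_self c hy, if_pos rfl, one_smul]
    · intro q _ hq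
      rw [red_self c hy, if_neg hq, zero_smul]
    · exact fun h => absurd hy h
  · rw [← sum_sigmaSet c x ⟨y, hy⟩]
    exact h ⟨y, hy⟩
  · rw [TopPath.act, pathClass_eq_zero I (by exact hy), zero_smul, Finset.sum_eq_zero]
    intro q _
    rw [red_of_loewy_lt c hσ hy, zero_smul]

variable (σ) in
/-- The span of the elements of `M` that belong to the paths of length at least `l` in `σ`. -/
noncomputable def layerSpan (I : Ideal (PathAlgebra K V)) [I.IsTwoSided]
    [Module (PathAlgebra K V ⧸ I) M] (x : ι → M) (l : ℕ) : Submodule K M :=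
  Submodule.span K ((fun y : TopPath e => y.act I x) '' {y | y ∈ σ ∧ l ≤ y.length})

theorem act_mem_layerSpan {x : ι → M} {l : ℕ} {y : TopPath e} (hy : y ∈ σ) (h : l ≤ y.length) :
    y.act I x ∈ layerSpan σ I x l :=
  Submodule.subset_span ⟨y, ⟨hy, h⟩, rfl⟩

theorem layerSpan_antitone {x : ι → M} {k l : ℕ} (h : k ≤ l) :
    layerSpan σ I x l ≤ layerSpan σ I x k :=
  Submodule.span_mono (Set.image_mono fun _ hy => ⟨hy.1, h.trans hy.2⟩)

theorem sum_red_mem_layerSpan (c : IndexN I σ → K) (x : ι → M) (y : TopPath e) :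
    ∑ q ∈ σ, red c y q • q.act I x ∈ layerSpan σ I x y.length := by
  refine Submodule.sum_mem _ fun q hq => ?_
  by_cases h : y.length ≤ q.length
  · exact Submodule.smul_mem _ _ (act_mem_layerSpan hq h)
  · rw [red_eq_zero c fun h' => h h'.1, zero_smul]
    exact Submodule.zero_mem _

theorem smul_mem_of_layerSpan {x : ι → M} {l k : ℕ} {r : PathAlgebra K V ⧸ I}
    (h : ∀ y ∈ σ, l ≤ y.length → r • y.act I x ∈ layerSpan σ I x k) {n : M}
    (hn : n ∈ layerSpan σ I x l) : r • n ∈ layerSpan σ I x k := by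
  have : layerSpan σ I x l ≤ (layerSpan σ I x k).comap (Algebra.lsmul K K M r) := by
    refine Submodule.span_le.2 ?_
    rintro _ ⟨y, hy, rfl⟩
    exact h y hy.1 hy.2
  exact this hn

variable [IsAdmissible I]

/-- Rewriting never shortens: a critical path is replaced by members of its `σ`-set, which are at
least as long. Each arrow therefore raises the length filtration by at least one. -/
theorem IsRelated.pathClass_smul_mem (hσ : IsPathSet I σ) {c : IndexN I σ → K} {x : ι → M}
    (h : IsRelated c x) {i j : V} (p : Quiver.Path i j) {l : ℕ} {n : M}
    (hn : n ∈ layerSpan σ I x l) : pathClass I ⟨i, j, p⟩ • n ∈ layerSpan σ I x (l + p.length) := by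
  induction p with
  | nil =>
    refine smul_mem_of_layerSpan (fun y hy hl => ?_) hn
    by_cases hi : i = y.tgt
    · subst hi
      have := vtx_smul_act (I := I) y x
      rw [vtx] at this
      rw [this]
      exact act_mem_layerSpan hy hl
    · rw [pathClass_smul_act_of_ne (by exact hi)]
      exact Submodule.zero_mem _
  | @cons j k p a ih =>
    have hc : pathClass I ⟨i, k, p.cons a⟩ =
        pathClass I ⟨_, _, Quiver.Hom.toPath a⟩ * pathClass I ⟨i, j, p⟩ := by
      rw [← pathClass_comp]
      rfl
    rw [hc, mul_smul]
    refine smul_mem_of_layerSpan (fun y hy hl => ?_) ih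
    by_cases hj : j = y.tgt
    · subst hj
      rw [← act_extend, h.act_eq hσ (hσ.isReducible_extend hy a)]
      refine layerSpan_antitone ?_ (sum_red_mem_layerSpan c x _)
      rw [TopPath.length_extend, Quiver.Path.length_cons]
      omega
    · rw [pathClass_smul_act_of_ne (by exact hj)]
      exact Submodule.zero_mem _

theorem IsRelated.layerSpan_zero (hσ : IsPathSet I σ) {c : IndexN I σ → K} {x : ι → M}
    (h : IsRelated c x) (hx : ∀ r, vtx I (e r) • x r = x r)
    (hs : Submodule.span (PathAlgebra K V ⧸ I) (Set.range x) = ⊤) : layerSpan σ I x 0 = ⊤ := by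
  -- The span of `σ` is stable under all paths, hence a `Λ`-submodule; it contains the generators
  -- because each path of length zero is reducible.
  let W : Submodule (PathAlgebra K V ⧸ I) M :=
    { layerSpan σ I x 0 with
      smul_mem' := fun r n hn => by
        have hr : r ∈ pathSpan I 0 := by rw [pathSpan_zero]; trivial
        have : pathSpan I 0 ≤ (layerSpan σ I x 0).comap
            ((LinearMap.toSpanSingleton (PathAlgebra K V ⧸ I) M n).restrictScalars K) := by
          refine Submodule.span_le.2 ?_
          rintro _ ⟨p, -, rfl⟩
          exact layerSpan_antitone (Nat.zero_le _) (h.pathClass_smul_mem hσ p.path hn)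
        exact this hr }
  have hW : W = ⊤ := by
    rw [eq_top_iff, ← hs, Submodule.span_le]
    rintro _ ⟨r, rfl⟩
    change x r ∈ layerSpan σ I x 0
    rw [← act_top (hx r), h.act_eq hσ (isReducible_top I σ r)]
    exact layerSpan_antitone (Nat.zero_le _) (sum_red_mem_layerSpan c x _)
  rw [eq_top_iff]
  intro n _
  have : n ∈ W := by rw [hW]; trivial
  exact this

theorem layerSpan_le_radPow (x : ι → M) (l : ℕ) :
    layerSpan σ I x l ≤ (radPow I M l).restrictScalars K := by
  refine Submodule.span_le.2 ?_
  rintro _ ⟨y, hy, rfl⟩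
  exact pathClass_smul_mem_radPow I hy.2 _

/-- Once `σ` spans `M`, paths of length at least `l` push all of `M` into level `l` of the length
filtration. Linear independence is not needed. -/
theorem IsRelated.radPow_eq (hσ : IsPathSet I σ) {c : IndexN I σ → K} {x : ι → M}
    (h : IsRelated c x) (h0 : layerSpan σ I x 0 = ⊤) (l : ℕ) :
    (radPow I M l).restrictScalars K = layerSpan σ I x l := by
  refine le_antisymm (restrictScalars_radPow_le I M fun p hp n => ?_) (layerSpan_le_radPow x l)
  refine layerSpan_antitone ?_ (h.pathClass_smul_mem hσ p.path (l := 0) (n := n) (h0 ▸ trivial))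
  omega

theorem disjoint_span_image_of_linearIndepOn {f : TopPath e → M}
    (h : LinearIndepOn K f (σ : Set (TopPath e)))
    {s t : Set (TopPath e)} (hs : s ⊆ σ) (ht : t ⊆ σ) (hst : Disjoint s t) :
    Disjoint (Submodule.span K (f '' s)) (Submodule.span K (f '' t)) := by
  have key (s : Set (TopPath e)) (hs : s ⊆ σ) :
      f '' s = (fun y : (σ : Set (TopPath e)) => f y) '' (Subtype.val ⁻¹' s) := by
    rw [show (fun y : (σ : Set (TopPath e)) => f y) = f ∘ Subtype.val from rfl, Set.image_comp,
      Subtype.image_preimage_coe, Set.inter_eq_right.2 hs]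
  rw [key s hs, key t ht]
  exact LinearIndependent.disjoint_span_image h (hst.preimage _)

/-- A criterion for skeleta. -/
theorem isSkeletonRel_of_linearIndepOn (hσ : IsPathSet I σ) {x : ι → M}
    (hx : ∀ r, vtx I (e r) • x r = x r)
    (hli : LinearIndepOn K (fun y : TopPath e => y.act I x) (σ : Set (TopPath e)))
    (hr : ∀ l, (radPow I M l).restrictScalars K = layerSpan σ I x l) : IsSkeletonRel I σ x := by
  have hlay (l : ℕ) : LinearIndependent K fun y : {y : TopPath e // y ∈ σ ∧ y.length = l} =>
      (radPow I M (l + 1)).mkQ (y.1.act I x) := by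
    have h₁ : LinearIndepOn K (fun y : TopPath e => y.act I x) {y | y ∈ σ ∧ y.length = l} :=
      hli.mono fun y hy => hy.1
    refine LinearIndependent.map (f := (radPow I M (l + 1)).mkQ.restrictScalars K) h₁ ?_
    -- Here `J^(l+1) M` is the span of the longer paths of the independent family, so it meets the
    -- span of the paths of length `l` trivially.
    rw [LinearMap.ker_restrictScalars, Submodule.ker_mkQ, hr, layerSpan,
      Set.range_comp' (fun y : TopPath e => y.act I x) Subtype.val, Subtype.range_coe]
    refine disjoint_span_image_of_linearIndepOn hli (fun y hy => hy.1) (fun y hy => hy.1) ?_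
    rw [Set.disjoint_left]
    rintro y ⟨-, hy⟩ ⟨-, hy'⟩
    omega
  have hroot : LinearIndependent K fun r : Root σ => (radPow I M 1).mkQ (x r) := by
    have := (hlay 0).comp (fun r : Root σ => ⟨TopPath.top e r, r.2, rfl⟩) (by
      rintro ⟨r, hr⟩ ⟨s, hs⟩ h
      simp only [Subtype.mk.injEq] at h
      exact Subtype.ext (congrArg TopPath.root h))
    convert this using 2 with r
    simp only [Function.comp_apply]
    rw [act_top (hx _)]
  refine ⟨fun r => hx r, fun r h => ?_, ?_, hroot, fun l _ => ?_, fun l _ => hlay l⟩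
  · refine hroot.ne_zero r ?_
    rw [Submodule.mkQ_apply, Submodule.Quotient.mk_eq_zero]
    exact h
  · rw [eq_top_iff]
    intro n _
    have hn : n ∈ layerSpan σ I x 0 := by
      rw [← hr, radPow_zero]; trivial
    have : layerSpan σ I x 0 ≤ (Submodule.span (PathAlgebra K V ⧸ I)
        (Set.range fun r : Root σ => x r)).restrictScalars K := by
      refine Submodule.span_le.2 ?_
      rintro _ ⟨y, hy, rfl⟩
      exact Submodule.smul_mem _ _ (Submodule.subset_span (Set.mem_range_self
        (⟨y.root, hσ.initial_mem _ _ y.top_isInitial hy.1⟩ : Root σ)))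
    exact this hn
  · rw [hr, hr, layerSpan, layerSpan, ← Submodule.span_union]
    congr 1
    ext n
    constructor
    · rintro ⟨y, ⟨hy, hl⟩, rfl⟩
      rcases hl.eq_or_lt with hl | hl
      · exact .inl ⟨⟨y, hy, hl.symm⟩, rfl⟩
      · exact .inr ⟨y, ⟨hy, hl⟩, rfl⟩
    · rintro (⟨⟨y, hy, hl⟩, rfl⟩ | ⟨y, ⟨hy, hl⟩, rfl⟩)
      · exact ⟨y, ⟨hy, hl.ge⟩, rfl⟩
      · exact ⟨y, ⟨hy, by omega⟩, rfl⟩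

/-- Descending induction from `J^(L+1) M = 0`, adding one layer at a time. The auxiliary `n` bounds
the distance to `L + 1`. -/
theorem IsSkeletonRel.radPow_eq {x : ι → M} (h : IsSkeletonRel I σ x) (l : ℕ) :
    (radPow I M l).restrictScalars K = layerSpan σ I x l := by
  refine le_antisymm ?_ (layerSpan_le_radPow x l)
  obtain ⟨n, hn⟩ : ∃ n, loewy I + 1 ≤ l + n := ⟨loewy I + 1, by omega⟩
  induction n generalizing l with
  | zero =>
    rw [radPow_of_loewy_lt I M (by omega)]
    exact fun n hn => (show n = 0 from hn) ▸ Submodule.zero_mem _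
  | succ n ih =>
    rcases lt_or_ge (loewy I) l with hl | hl
    · rw [radPow_of_loewy_lt I M hl]
      exact fun n hn => (show n = 0 from hn) ▸ Submodule.zero_mem _
    · rw [h.layer_span l hl]
      refine sup_le ?_ ((ih (l + 1) (by omega)).trans (layerSpan_antitone (by omega)))
      refine Submodule.span_le.2 ?_
      rintro _ ⟨y, rfl⟩
      exact act_mem_layerSpan y.2.1 y.2.2.ge

/-- Ascending induction on length: modulo `J^(n+1) M` the longer paths vanish and the shorter ones
already have coefficient zero, so independence in layer `n` applies. -/
theorem IsSkeletonRel.linearIndepOn (hσ : IsPathSet I σ) {x : ι → M} (h : IsSkeletonRel I σ x) :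
    LinearIndepOn K (fun y : TopPath e => y.act I x) (σ : Set (TopPath e)) := by
  classical
  rw [linearIndepOn_finset_iff]
  intro f hf
  suffices ∀ n, ∀ y ∈ σ, y.length = n → f y = 0 from fun y hy => this _ y hy rfl
  intro n
  induction n using Nat.strong_induction_on with
  | _ n ih =>
    intro y hy hyn
    have hli := h.layer_linearIndependent n (hyn ▸ hσ.length_le y hy)
    have hli' : LinearIndepOn K (fun y : TopPath e => (radPow I M (n + 1)).mkQ (y.act I x))
        (σ.filter fun y => y.length = n : Finset (TopPath e)) := by
      rw [Finset.coe_filter]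
      exact hli
    rw [linearIndepOn_finset_iff] at hli'
    refine hli' f ?_ y (Finset.mem_filter.2 ⟨hy, hyn⟩)
    have h0 : ∑ y ∈ σ, f y • (radPow I M (n + 1)).mkQ (y.act I x) = 0 := by
      have := congrArg ((radPow I M (n + 1)).mkQ.restrictScalars K) hf
      rw [map_sum, map_zero] at this
      simp only [map_smul] at this
      exact this
    refine Eq.trans ?_ h0
    rw [Finset.sum_filter]
    refine Finset.sum_congr rfl fun y hy => ?_
    split_ifs with hyn
    · rfl
    · rcases lt_or_gt_of_ne hyn with hl | hl
      · rw [ih _ hl y hy rfl, zero_smul]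
      · have : (radPow I M (n + 1)).mkQ (y.act I x) = 0 := by
          rw [Submodule.mkQ_apply, Submodule.Quotient.mk_eq_zero]
          exact pathClass_smul_mem_radPow I hl _
        rw [this, smul_zero]

/-- The length of the path locates it in a power of the radical, which leaves only members of `σ`
that are at least as long. The idempotent of its end vertex then kills those ending elsewhere. This
explains the shape of the `σ`-set. -/
theorem IsSkeletonRel.act_mem_span {x : ι → M} (h : IsSkeletonRel I σ x) (y : TopPath e) :
    y.act I x ∈ Submodule.span K (Set.range fun q : ↥(sigmaSet σ y) => q.1.act I x) := by
  have h₀ : y.act I x ∈ radPow I M y.length :=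
    pathClass_smul_mem_radPow I (p := ⟨_, _, y.path⟩) le_rfl (x y.root)
  have h₁ : y.act I x ∈ layerSpan σ I x y.length := (h.radPow_eq y.length).le h₀
  have h₂ : layerSpan σ I x y.length ≤ (Submodule.span K
      (Set.range fun q : ↥(sigmaSet σ y) => q.1.act I x)).comap
        (Algebra.lsmul K K M (vtx I y.tgt)) := by
    refine Submodule.span_le.2 ?_
    rintro _ ⟨q, ⟨hq, hl⟩, rfl⟩
    change vtx I y.tgt • q.act I x ∈ Submodule.span K _
    by_cases hy : y.tgt = q.tgt
    · rw [hy, vtx_smul_act]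
      exact Submodule.subset_span ⟨⟨q, mem_sigmaSet.2 ⟨hq, hl, hy.symm⟩⟩, rfl⟩
    · rw [vtx, pathClass_smul_act_of_ne (by exact hy)]
      exact Submodule.zero_mem _
  have h₃ : vtx I y.tgt • y.act I x ∈ Submodule.span K _ := h₂ h₁
  rwa [vtx_smul_act] at h₃

theorem IsSkeletonRel.exists_isRelated {x : ι → M} (h : IsSkeletonRel I σ x) :
    ∃ c : IndexN I σ → K, IsRelated c x := by
  choose f hf using fun y : CritPath I σ =>
    (Submodule.mem_span_range_iff_exists_fun K).1 (h.act_mem_span y.1)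
  exact ⟨fun ν => f ν.1 ν.2, fun y => (hf y).symm⟩

theorem IsRelated.unique {x : ι → M}
    (hli : LinearIndepOn K (fun y : TopPath e => y.act I x) (σ : Set (TopPath e)))
    {c c' : IndexN I σ → K} (h : IsRelated c x) (h' : IsRelated c' x) : c = c' := by
  funext ⟨y, q⟩
  have h0 : ∑ q ∈ σ, (red c y.1 q - red c' y.1 q) • q.act I x = 0 := by
    simp only [sub_smul, Finset.sum_sub_distrib]
    rw [← sum_sigmaSet, ← sum_sigmaSet, ← h y, ← h' y, sub_self]
  have := linearIndepOn_finset_iff.1 hli _ h0 q.1 (mem_sigmaSet.1 q.2).1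
  rwa [red_crit, red_crit, sub_eq_zero] at this

end Module

end

end BoundQuiver

/-! ### The matrix representation of the path algebra attached to a family of coefficients. -/

namespace BoundQuiver

section

variable {K : Type u} [Field K] {V : Type v} [Quiver.{w + 1} V] [Fintype V]
variable {ι : Type z} {e : ι → V}
variable {I : Ideal (PathAlgebra K V)} [I.IsTwoSided] {σ : Finset (TopPath e)}

open Matrix

open Classical in
/-- The idempotent matrix that belongs to a vertex. -/
noncomputable def vtxMat (K : Type u) [Field K] (σ : Finset (TopPath e)) (i : V) : Matrix σ σ K :=
  Matrix.diagonal fun q => if q.1.tgt = i then 1 else 0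

open Classical in
/-- The matrix by which an arrow acts on the space with basis `σ`, for a family of coefficients. -/
noncomputable def arrowMat (c : IndexN I σ → K) {i j : V} (a : i ⟶ j) : Matrix σ σ K :=
  fun q' q => if h : i = q.1.tgt then red c (q.1.extend (h ▸ a)) q' else 0

/-- The matrix by which a path acts on the space with basis `σ`, for a family of coefficients. -/
noncomputable def pathMat (c : IndexN I σ → K) {i : V} : ∀ {j : V}, Quiver.Path i j → Matrix σ σ K
  | _, .nil => vtxMat K σ i
  | _, .cons p a => arrowMat c a * pathMat c p

theorem arrowMat_apply (c : IndexN I σ → K) (q' q : σ) {j : V} (a : q.1.tgt ⟶ j) :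
    arrowMat c a q' q = red c (q.1.extend a) q' := by
  rw [arrowMat, dif_pos rfl]

theorem arrowMat_apply_of_ne (c : IndexN I σ → K) {i j : V} (a : i ⟶ j) (q' q : σ)
    (h : i ≠ q.1.tgt) : arrowMat c a q' q = 0 := by
  rw [arrowMat, dif_neg h]

theorem vtxMat_mul_self (i : V) : vtxMat K σ i * vtxMat K σ i = vtxMat K σ i := by
  classical
  rw [vtxMat, Matrix.diagonal_mul_diagonal]
  congr
  funext q
  simp

theorem vtxMat_mul_of_ne {i j : V} (h : i ≠ j) : vtxMat K σ i * vtxMat K σ j = 0 := by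
  classical
  rw [vtxMat, vtxMat, Matrix.diagonal_mul_diagonal, Matrix.diagonal_eq_zero]
  funext q
  simp only [mul_ite, mul_one, mul_zero, Pi.zero_apply]
  split_ifs with h₁ h₂
  · exact absurd (h₂.symm.trans h₁) h
  · rfl
  · rfl

theorem vtxMat_mul_arrowMat (c : IndexN I σ → K) {i j : V} (a : i ⟶ j) :
    vtxMat K σ j * arrowMat c a = arrowMat c a := by
  classical
  ext q' q
  rw [vtxMat, Matrix.diagonal_mul]
  split_ifs with h
  · rw [one_mul]
  · by_cases hi : i = q.1.tgt
    · subst hi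
      rw [zero_mul, arrowMat_apply, red_eq_zero]
      exact fun h' => h h'.2
    · rw [arrowMat_apply_of_ne c a q' q hi, mul_zero]

theorem vtxMat_mul_pathMat (c : IndexN I σ → K) {i j : V} (p : Quiver.Path i j) :
    vtxMat K σ j * pathMat c p = pathMat c p := by
  cases p with
  | nil => exact vtxMat_mul_self i
  | cons p a => rw [pathMat, ← Matrix.mul_assoc, vtxMat_mul_arrowMat]

theorem pathMat_mul_vtxMat (c : IndexN I σ → K) {i j : V} (p : Quiver.Path i j) :
    pathMat c p * vtxMat K σ i = pathMat c p := by
  induction p with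
  | nil => exact vtxMat_mul_self i
  | cons p a ih => rw [pathMat, Matrix.mul_assoc, ih]

theorem pathMat_comp (c : IndexN I σ → K) {i j k : V} (p : Quiver.Path i j) (q : Quiver.Path j k) :
    pathMat c (p.comp q) = pathMat c q * pathMat c p := by
  induction q with
  | nil => rw [Quiver.Path.comp_nil, pathMat, vtxMat_mul_pathMat]
  | cons q a ih => rw [Quiver.Path.comp_cons, pathMat, pathMat, ih, Matrix.mul_assoc]

/-- The representation of the path algebra on the space with basis `σ` that belongs to a family of
coefficients. -/
noncomputable def rep (c : IndexN I σ → K) : PathAlgebra K V →ₗ[K] Matrix σ σ K :=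
  Finsupp.linearCombination K fun p : AnyPath V => pathMat c p.path

theorem rep_of (c : IndexN I σ → K) (p : AnyPath V) :
    rep c (PathAlgebra.of K p) = pathMat c p.path :=
  (Finsupp.linearCombination_single K (1 : K) p).trans (one_smul K _)

theorem rep_mul (c : IndexN I σ → K) (x y : PathAlgebra K V) :
    rep c (x * y) = rep c x * rep c y := by
  induction x using PathAlgebra.induction_on with
  | zero => simp
  | add x x' hx hx' => simp only [add_mul, map_add, hx, hx']
  | smul_of a p =>
    induction y using PathAlgebra.induction_on with
    | zero => simp
    | add y y' hy hy' => simp only [mul_add, map_add, hy, hy']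
    | smul_of b q =>
      simp only [PathAlgebra.smul_mul', PathAlgebra.mul_smul', map_smul, Matrix.smul_mul,
        Matrix.mul_smul]
      congr 2
      by_cases h : p.src = q.tgt
      · obtain ⟨j, k, p⟩ := p
        obtain ⟨i, j', q⟩ := q
        obtain rfl : j = j' := h
        rw [← PathAlgebra.of_comp, rep_of, rep_of, rep_of, pathMat_comp]
      -- For paths that do not compose, inserting the idempotents at the endpoints makes
      -- orthogonality annihilate the product of matrices.
      · rw [PathAlgebra.of_mul_of_ne h, map_zero, rep_of, rep_of, ← pathMat_mul_vtxMat c p.path,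
          ← vtxMat_mul_pathMat c q.path, Matrix.mul_assoc, ← Matrix.mul_assoc (vtxMat K σ p.src),
          vtxMat_mul_of_ne h, Matrix.zero_mul, Matrix.mul_zero]

/-- The representation that belongs to `c` is annihilated by the ideal `I`. -/
def IsGood (c : IndexN I σ → K) : Prop := ∀ ρ ∈ I, rep c ρ = 0

/-- Multiplicativity of `rep` passes from an element to its left multiples, so generators of `I` as
a left ideal suffice. -/
theorem isGood_iff (c : IndexN I σ → K) {R : Set (PathAlgebra K V)} (hR : Ideal.span R = I) :
    IsGood c ↔ ∀ ρ ∈ R, rep c ρ = 0 := by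
  refine ⟨fun h ρ hρ => h ρ (hR ▸ Ideal.subset_span hρ), fun h ρ hρ => ?_⟩
  have hρ' : ρ ∈ Ideal.span R := hR ▸ hρ
  induction hρ' using Submodule.span_induction with
  | mem x hx => exact h x hx
  | zero => exact map_zero _
  | add x y hx hy h₁ h₂ => rw [map_add, h₁ (hR ▸ hx), h₂ (hR ▸ hy), add_zero]
  | smul a x hx h₁ => rw [smul_eq_mul, rep_mul, h₁ (hR ▸ hx), Matrix.mul_zero]

section Module

variable {M : Type*} [AddCommGroup M] [Module (PathAlgebra K V ⧸ I) M] [Module K M]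
  [IsScalarTower K (PathAlgebra K V ⧸ I) M]

/-- The matrix `T` describes the action of `t` on the elements that belong to the paths in `σ`. -/
def Intertwines (x : ι → M) (T : Matrix σ σ K) (t : PathAlgebra K V ⧸ I) : Prop :=
  ∀ q : σ, ∑ q' : σ, T q' q • q'.1.act I x = t • q.1.act I x

theorem Intertwines.mul {x : ι → M} {T T' : Matrix σ σ K} {t t' : PathAlgebra K V ⧸ I}
    (h : Intertwines x T t) (h' : Intertwines x T' t') : Intertwines x (T * T') (t * t') := by
  intro q
  simp only [Matrix.mul_apply, Finset.sum_smul]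
  rw [Finset.sum_comm, mul_smul, ← h' q, Finset.smul_sum]
  refine Finset.sum_congr rfl fun s _ => ?_
  rw [smul_comm, ← h s, Finset.smul_sum]
  refine Finset.sum_congr rfl fun q' _ => ?_
  rw [smul_smul, mul_comm]

/-- The column of an arrow matrix at `q` is the rewriting of `q` extended by the arrow, so it
expresses the true action in any module satisfying the relations. Independence of `σ` plays no role
here. -/
theorem IsRelated.intertwines_pathMat [IsAdmissible I] (hσ : IsPathSet I σ) {c : IndexN I σ → K}
    {x : ι → M} (h : IsRelated c x) {i j : V} (p : Quiver.Path i j) :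
    Intertwines x (pathMat c p) (pathClass I ⟨i, j, p⟩) := by
  classical
  induction p with
  | nil =>
    intro q
    rw [Finset.sum_eq_single q]
    · rw [pathMat, vtxMat, Matrix.diagonal_apply_eq]
      split_ifs with hq
      · subst hq
        rw [one_smul]
        exact (vtx_smul_act _ _).symm
      · rw [zero_smul, pathClass_smul_act_of_ne (by exact Ne.symm hq)]
    · intro q' _ hq
      rw [pathMat, vtxMat, Matrix.diagonal_apply_ne _ hq, zero_smul]
    · exact fun h => absurd (Finset.mem_univ _) h
  | @cons j k p a ih =>
    have hc : pathClass I ⟨i, k, p.cons a⟩ =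
        pathClass I ⟨_, _, Quiver.Hom.toPath a⟩ * pathClass I ⟨i, j, p⟩ := by
      rw [← pathClass_comp]
      rfl
    rw [hc, pathMat]
    refine Intertwines.mul (fun q => ?_) ih
    by_cases hj : j = q.1.tgt
    · subst hj
      rw [← act_extend, h.act_eq hσ (hσ.isReducible_extend q.2 a), ← Finset.sum_coe_sort σ]
      simp only [arrowMat_apply]
    · rw [pathClass_smul_act_of_ne (by exact hj), Finset.sum_eq_zero]
      intro q' _
      rw [arrowMat_apply_of_ne c a q' q hj, zero_smul]

theorem IsRelated.intertwines_rep [IsAdmissible I] (hσ : IsPathSet I σ) {c : IndexN I σ → K}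
    {x : ι → M} (h : IsRelated c x) (ρ : PathAlgebra K V) :
    Intertwines x (rep c ρ) (Ideal.Quotient.mk I ρ) := by
  induction ρ using PathAlgebra.induction_on with
  | zero => intro q; simp
  | add ρ ρ' h₁ h₂ =>
    intro q
    simp only [map_add, Matrix.add_apply, add_smul, Finset.sum_add_distrib]
    rw [h₁ q, h₂ q]
  | smul_of a p =>
    intro q
    rw [map_smul, mk_smul, rep_of, smul_assoc]
    have := h.intertwines_pathMat hσ p.path q
    rw [pathClass] at this
    rw [← this, Finset.smul_sum]
    simp only [Matrix.smul_apply, smul_assoc]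

/-- Elements of `I` act as zero on a `Λ`-module, and on a linearly independent family the zero
action has only the zero matrix. -/
theorem IsRelated.isGood [IsAdmissible I] (hσ : IsPathSet I σ) {c : IndexN I σ → K}
    {x : ι → M} (h : IsRelated c x)
    (hli : LinearIndepOn K (fun y : TopPath e => y.act I x) (σ : Set (TopPath e))) : IsGood c := by
  intro ρ hρ
  ext q' q
  have h₁ := h.intertwines_rep hσ ρ q
  rw [Ideal.Quotient.eq_zero_iff_mem.2 hρ, zero_smul] at h₁
  exact Fintype.linearIndependent_iff.1 hli _ h₁ q'

end Module

/-! ### Polynomial dependence on the coefficients, and fields of definition. -/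

section Polynomial

variable {F : Type*} [Field F] [Algebra F K]

open QP

theorem zero_mem_polyFun {M : Type*} : (fun _ : M → K => (0 : K)) ∈ polyFun F K M :=
  zero_mem (polyFun F K M)

theorem one_mem_polyFun {M : Type*} : (fun _ : M → K => (1 : K)) ∈ polyFun F K M :=
  one_mem (polyFun F K M)

theorem red_mem_polyFun (y q : TopPath e) :
    (fun c : IndexN I σ → K => red c y q) ∈ polyFun F K (IndexN I σ) := by
  unfold red
  by_cases h₁ : y ∈ σ
  · simp only [if_pos h₁]
    by_cases h₂ : q = y
    · simp only [if_pos h₂]; exact one_mem_polyFun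
    · simp only [if_neg h₂]; exact zero_mem_polyFun
  · simp only [if_neg h₁]
    by_cases h₂ : IsCritical I σ y ∧ q ∈ sigmaSet σ y
    · simp only [dif_pos h₂]; exact coord_mem_polyFun _
    · simp only [dif_neg h₂]; exact zero_mem_polyFun

theorem pathMat_mem_polyFun {i j : V} (p : Quiver.Path i j) (q' q : σ) :
    (fun c : IndexN I σ → K => pathMat c p q' q) ∈ polyFun F K (IndexN I σ) := by
  classical
  induction p generalizing q' q with
  | nil =>
    simp only [pathMat, vtxMat, Matrix.diagonal_apply]
    split_ifs
    · exact one_mem_polyFun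
    · exact zero_mem_polyFun
    · exact zero_mem_polyFun
  | @cons j k p a ih =>
    simp only [pathMat, Matrix.mul_apply]
    refine sum_mem_polyFun _ fun s _ => mul_mem_polyFun ?_ (ih s q)
    by_cases hj : j = s.1.tgt
    · subst hj
      simp only [arrowMat_apply]
      exact red_mem_polyFun _ _
    · simp only [arrowMat_apply_of_ne _ a q' s hj]
      exact zero_mem_polyFun

theorem rep_mem_polyFun (ρ : PathAlgebra K V) (hρ : ∀ p, ∃ a : F, algebraMap F K a = ρ.coeff p)
    (q' q : σ) : (fun c : IndexN I σ → K => rep c ρ q' q) ∈ polyFun F K (IndexN I σ) := by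
  obtain ⟨s, hs⟩ := ρ.eq_sum_coeff
  have h (c : IndexN I σ → K) : rep c ρ q' q =
      ∑ p ∈ s, ρ.coeff p * pathMat c p.path q' q := by
    rw [hs, map_sum, Matrix.sum_apply, ← hs]
    refine Finset.sum_congr rfl fun p _ => ?_
    rw [map_smul, rep_of, Matrix.smul_apply, smul_eq_mul]
  simp only [h]
  refine sum_mem_polyFun _ fun p _ => mul_mem_polyFun ?_ (pathMat_mem_polyFun _ _ _)
  obtain ⟨a, ha⟩ := hρ p
  rw [← ha]
  exact const_mem_polyFun a

theorem finite_topPath [∀ a b : V, Finite (a ⟶ b)] [Finite ι] (m : ℕ) :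
    Finite {y : TopPath e // y.length < m} := by
  have : Finite {p : AnyPath V | p.path.length < m} := finite_paths m
  refine Finite.of_injective (β := ι × {p : AnyPath V | p.path.length < m})
    (fun y => (y.1.root, ⟨⟨_, _, y.1.path⟩, y.2⟩)) ?_
  rintro ⟨⟨r, i, p⟩, hp⟩ ⟨⟨s, j, q⟩, hq⟩ h
  obtain rfl : r = s := congrArg Prod.fst h
  have h := congrArg (fun t => t.2.1) h
  simp only [AnyPath.mk.injEq, true_and] at h
  obtain ⟨rfl, h⟩ := h
  obtain rfl := eq_of_heq h
  rfl

instance finite_indexN [∀ a b : V, Finite (a ⟶ b)] [Finite ι] : Finite (IndexN I σ) := by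
  have := finite_topPath (e := e) (loewy I + 1)
  have : Finite (CritPath I σ) := Finite.of_injective
    (fun y => (⟨y.1, Nat.lt_succ_of_le y.2.2.1⟩ : {y : TopPath e // y.length < loewy I + 1}))
    fun y y' h => Subtype.ext (Subtype.mk.inj h)
  infer_instance

/-- The set of the families of coefficients that satisfy the relations is defined over every field
over which the ideal has a set of generators. -/
theorem exists_finset_isGood [∀ a b : V, Finite (a ⟶ b)] [Finite ι] {R : Set (PathAlgebra K V)}
    (hR : Ideal.span R = I) (hF : ∀ ρ ∈ R, ∀ p, ∃ a : F, algebraMap F K a = ρ.coeff p) :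
    ∃ S : Finset (MvPolynomial (IndexN I σ) F),
      {c : IndexN I σ → K | IsGood c} = {c | ∀ f ∈ S, MvPolynomial.aeval c f = 0} := by
  obtain ⟨S, hS⟩ := exists_finset_zeroLocus (F := F) (M := IndexN I σ)
    (g := fun (i : R × σ × σ) (c : IndexN I σ → K) => rep c i.1.1 i.2.1 i.2.2)
    fun i => rep_mem_polyFun i.1.1 (hF _ i.1.2) _ _
  refine ⟨S, ?_⟩
  rw [← hS]
  ext c
  rw [Set.mem_ofPred_eq, Set.mem_ofPred_eq, isGood_iff c hR]
  refine ⟨fun h i => by rw [h _ i.1.2]; rfl, fun h ρ hρ => ?_⟩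
  ext q' q
  exact h (⟨ρ, hρ⟩, q', q)

theorem isClosed_isGood : (affineSpace K (IndexN I σ)).IsClosed {c | IsGood c} := by
  have := isClosed_zeroLocus (K := K) (M := IndexN I σ)
    (g := fun (i : I × σ × σ) (c : IndexN I σ → K) => rep c i.1.1 i.2.1 i.2.2)
    fun i => rep_mem_polyFun i.1.1 (fun p => ⟨_, rfl⟩) _ _
  convert this using 1
  ext c
  refine ⟨fun h i => by rw [h _ i.1.2]; rfl, fun h ρ hρ => ?_⟩
  ext q' q
  exact h (⟨ρ, hρ⟩, q', q)

end Polynomial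

/-! ### The submodule that belongs to a family of coefficients -/

section Kernel

/-- The vector of the coefficients of a path that are prescribed by `c`. -/
noncomputable def redVec (c : IndexN I σ → K) (y : TopPath e) : σ → K := fun q => red c y q

theorem redVec_of_mem [DecidableEq σ] (c : IndexN I σ → K) {y : TopPath e} (hy : y ∈ σ) :
    redVec c y = Pi.single (⟨y, hy⟩ : σ) 1 := by
  classical
  funext s
  rw [redVec, red_self c hy, Pi.single_apply]
  simp only [Subtype.ext_iff]

/-- The vector of the coefficients of a distinguished top element. -/
noncomputable def topVec (c : IndexN I σ → K) (r : ι) : σ → K := redVec c (TopPath.top e r)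

theorem vtxMat_mulVec_topVec (c : IndexN I σ → K) (r : ι) :
    vtxMat K σ (e r) *ᵥ topVec c r = topVec c r := by
  classical
  funext q
  rw [vtxMat, Matrix.mulVec_diagonal]
  split_ifs with h
  · rw [one_mul]
  · rw [zero_mul, topVec, redVec, red_eq_zero]
    exact fun h' => h h'.2

/-- Along the path each proper initial subpath is in `σ`, so its vector is a unit vector; applying
the next arrow matrix selects the column that holds the next vector of coefficients. -/
theorem pathMat_mulVec_topVec (c : IndexN I σ → K) (y : TopPath e)
    (hy : ∀ x : TopPath e, x.IsInitial y → x ≠ y → x ∈ σ) :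
    pathMat c y.path *ᵥ topVec c y.root = redVec c y := by
  classical
  obtain ⟨r, j, p⟩ := y
  induction p with
  | nil => exact vtxMat_mulVec_topVec c r
  | @cons i j p a ih =>
    let y : TopPath e := ⟨r, i, p⟩
    have hne (x : TopPath e) (hx : x.IsInitial y) : x ≠ y.extend a := by
      rintro rfl
      have := hx.length_le
      rw [TopPath.length_extend] at this
      omega
    have hmem : y ∈ σ := hy _ (y.isInitial_extend_self a) (hne y ⟨.nil, rfl⟩)
    have h₁ : pathMat c p *ᵥ topVec c r = redVec c y :=
      ih fun x hx _ => hy x (hx.extend a) (hne x hx)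
    change (arrowMat c a * pathMat c p) *ᵥ topVec c r = redVec c (y.extend a)
    rw [← Matrix.mulVec_mulVec, h₁, redVec_of_mem c hmem, Matrix.mulVec_single_one]
    funext q
    exact arrowMat_apply c q ⟨y, hmem⟩ a

variable (I) in
/-- A representative of a residue class. -/
noncomputable def lift (x : PathAlgebra K V ⧸ I) : PathAlgebra K V :=
  Function.surjInv Ideal.Quotient.mk_surjective x

theorem IsGood.rep_lift {c : IndexN I σ → K} (hc : IsGood c) (y : PathAlgebra K V) :
    rep c (lift I (Ideal.Quotient.mk I y)) = rep c y := by
  have : lift I (Ideal.Quotient.mk I y) - y ∈ I := by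
    rw [← Ideal.Quotient.eq]
    exact Function.surjInv_eq Ideal.Quotient.mk_surjective _
  rw [← sub_eq_zero, ← map_sub]
  exact hc _ this

theorem mk_lift (x : PathAlgebra K V ⧸ I) : Ideal.Quotient.mk I (lift I x) = x :=
  Function.surjInv_eq Ideal.Quotient.mk_surjective _

variable [Fintype ι]

/-- The map of `Q` to the space with basis `σ` which sends the distinguished top elements to their
vectors of coefficients. -/
noncomputable def evalFun (c : IndexN I σ → K) (x : Proj I e) : σ → K :=
  ∑ r, rep c (lift I (x r).1) *ᵥ topVec c r

/-- The chosen representatives are not additive, but the discrepancy lies in `I`, which a good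
representation annihilates. The same remark gives compatibility with the actions of `Λ` and `K`. -/
theorem IsGood.evalFun_add {c : IndexN I σ → K} (hc : IsGood c) (x y : Proj I e) :
    evalFun c (x + y) = evalFun c x + evalFun c y := by
  rw [evalFun, evalFun, evalFun, ← Finset.sum_add_distrib]
  refine Finset.sum_congr rfl fun r _ => ?_
  rw [← Matrix.add_mulVec, ← map_add, ← hc.rep_lift (_ + _), map_add, mk_lift, mk_lift]
  rfl

theorem IsGood.evalFun_smul {c : IndexN I σ → K} (hc : IsGood c) (t : PathAlgebra K V ⧸ I)
    (x : Proj I e) : evalFun c (t • x) = rep c (lift I t) *ᵥ evalFun c x := by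
  rw [evalFun, evalFun, Matrix.mulVec_sum]
  refine Finset.sum_congr rfl fun r _ => ?_
  rw [Matrix.mulVec_mulVec, ← rep_mul, ← hc.rep_lift (_ * _), map_mul, mk_lift, mk_lift]
  rfl

theorem IsGood.evalFun_smul' {c : IndexN I σ → K} (hc : IsGood c) (a : K)
    (x : Proj I e) : evalFun c (a • x) = a • evalFun c x := by
  rw [evalFun, evalFun, Finset.smul_sum]
  refine Finset.sum_congr rfl fun r _ => ?_
  rw [← Matrix.smul_mulVec, ← map_smul, ← hc.rep_lift (a • _), mk_smul, mk_lift]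
  rfl

/-- The map `evalFun`, as a linear map. -/
noncomputable def evalLin {c : IndexN I σ → K} (hc : IsGood c) : Proj I e →ₗ[K] σ → K where
  toFun := evalFun c
  map_add' := hc.evalFun_add
  map_smul' := hc.evalFun_smul'

theorem IsGood.evalFun_topElt {c : IndexN I σ → K} (hc : IsGood c) (r : ι) :
    evalFun c (topElt I e r) = topVec c r := by
  classical
  rw [evalFun, Finset.sum_eq_single r]
  · have : (topElt I e r r).1 = Ideal.Quotient.mk I (PathAlgebra.of K ⟨e r, e r, .nil⟩) := by
      rw [topElt, Pi.single_eq_same]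
      rfl
    rw [this, hc.rep_lift, rep_of]
    exact vtxMat_mulVec_topVec c r
  · intro s _ hs
    have : (topElt I e r s).1 = Ideal.Quotient.mk I 0 := by
      rw [topElt, Pi.single_eq_of_ne hs]
      rfl
    rw [this, hc.rep_lift, map_zero, Matrix.zero_mulVec]
  · exact fun h => absurd (Finset.mem_univ _) h

theorem IsGood.evalFun_elt {c : IndexN I σ → K} (hc : IsGood c) (y : TopPath e)
    (hy : ∀ x : TopPath e, x.IsInitial y → x ≠ y → x ∈ σ) :
    evalFun c (y.elt I) = redVec c y := by
  change evalFun c (pathClass I ⟨_, _, y.path⟩ • topElt I e y.root) = _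
  rw [hc.evalFun_smul, hc.evalFun_topElt, pathClass, hc.rep_lift, rep_of]
  exact pathMat_mulVec_topVec c y hy

/-- The submodule of `Q` that belongs to a family of coefficients. -/
noncomputable def kerSubmodule {c : IndexN I σ → K} (hc : IsGood c) :
    Submodule (PathAlgebra K V ⧸ I) (Proj I e) where
  carrier := {x | evalFun c x = 0}
  add_mem' {x y} hx hy := by
    rw [Set.mem_ofPred_eq] at *
    rw [hc.evalFun_add, hx, hy, add_zero]
  zero_mem' := map_zero (evalLin hc)
  smul_mem' t x hx := by
    rw [Set.mem_ofPred_eq] at *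
    rw [hc.evalFun_smul, hx, Matrix.mulVec_zero]

end Kernel

/-! ### Skeleta of the quotients of `Q` -/

theorem mkQ_elt (C : Submodule (PathAlgebra K V ⧸ I) (Proj I e)) (y : TopPath e) :
    C.mkQ (y.elt I) = y.act I fun r => C.mkQ (topElt I e r) :=
  map_smul _ _ _

theorem vtx_smul_topElt (r : ι) : vtx I (e r) • topElt I e r = topElt I e r := by
  classical
  rw [topElt, ← Pi.single_smul]
  congr 1
  exact Subtype.ext (vtx_mul_pathClass I .nil)

theorem vtx_smul_mkQ (C : Submodule (PathAlgebra K V ⧸ I) (Proj I e)) (r : ι) :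
    vtx I (e r) • C.mkQ (topElt I e r) = C.mkQ (topElt I e r) := by
  rw [← map_smul, vtx_smul_topElt]

theorem span_topElt [Finite ι] :
    Submodule.span (PathAlgebra K V ⧸ I) (Set.range (topElt I e)) = ⊤ := by
  classical
  have := Fintype.ofFinite ι
  rw [eq_top_iff]
  rintro x -
  have hx : x = ∑ r, (x r).1 • topElt I e r := by
    have h (r : ι) : (x r).1 • topElt I e r = Pi.single r (x r) := by
      rw [topElt, ← Pi.single_smul]
      congr 1
      refine Subtype.ext ?_
      obtain ⟨t, ht⟩ := Submodule.mem_span_singleton.1 (x r).2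
      change (x r).1 * vtx I (e r) = (x r).1
      rw [← ht, smul_eq_mul, mul_assoc]
      exact congrArg (t * ·) (vtx_mul_pathClass I .nil)
    simp only [h]
    exact (Finset.univ_sum_single x).symm
  rw [hx]
  exact Submodule.sum_mem _ fun r _ => Submodule.smul_mem _ _ (Submodule.subset_span ⟨r, rfl⟩)

theorem span_mkQ_topElt [Finite ι] (C : Submodule (PathAlgebra K V ⧸ I) (Proj I e)) :
    Submodule.span (PathAlgebra K V ⧸ I) (Set.range fun r => C.mkQ (topElt I e r)) = ⊤ := by
  rw [Set.range_comp' C.mkQ (topElt I e), ← Submodule.map_span, span_topElt, Submodule.map_top,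
    Submodule.range_mkQ]

theorem isCoeff_iff (C : Submodule (PathAlgebra K V ⧸ I) (Proj I e)) (c : IndexN I σ → K) :
    IsCoeff C c ↔ IsRelated c fun r => C.mkQ (topElt I e r) := by
  simp only [IsCoeff, IsRelated, mkQ_elt]

variable [IsAdmissible I]

theorem IsCoeff.layerSpan_zero [Finite ι] (hσ : IsPathSet I σ)
    {C : Submodule (PathAlgebra K V ⧸ I) (Proj I e)} {c : IndexN I σ → K} (h : IsCoeff C c) :
    layerSpan σ I (fun r => C.mkQ (topElt I e r)) 0 = ⊤ :=
  ((isCoeff_iff C c).1 h).layerSpan_zero hσ (vtx_smul_mkQ C) (span_mkQ_topElt C)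

theorem IsCoeff.isDistinguished [Finite ι] (hσ : IsPathSet I σ)
    {C : Submodule (PathAlgebra K V ⧸ I) (Proj I e)} {c : IndexN I σ → K} (h : IsCoeff C c)
    (hli : LinearIndepOn K (fun y : TopPath e => y.act I fun r => C.mkQ (topElt I e r))
      (σ : Set (TopPath e))) : IsDistinguished I σ C :=
  isSkeletonRel_of_linearIndepOn hσ (vtx_smul_mkQ C) hli
    (((isCoeff_iff C c).1 h).radPow_eq hσ (h.layerSpan_zero hσ))

theorem IsGood.evalFun_elt_of_mem [Fintype ι] [DecidableEq σ] (hσ : IsPathSet I σ)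
    {c : IndexN I σ → K} (hc : IsGood c) {y : TopPath e} (hy : y ∈ σ) :
    evalFun c (y.elt I) = Pi.single (⟨y, hy⟩ : σ) 1 := by
  rw [hc.evalFun_elt y fun x hx _ => hσ.initial_mem x y hx hy, redVec_of_mem c hy]

theorem sum_red_mkQ (C : Submodule (PathAlgebra K V ⧸ I) (Proj I e)) (f : TopPath e → K) :
    ∑ q ∈ σ, f q • q.act I (fun r => C.mkQ (topElt I e r)) =
      C.mkQ (∑ q ∈ σ, f q • q.elt I) := by
  change _ = C.mkQ.restrictScalars K _
  rw [map_sum]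
  refine Finset.sum_congr rfl fun q _ => ?_
  rw [map_smul]
  exact congrArg _ (mkQ_elt C q).symm

theorem IsGood.evalFun_sum [Fintype ι] (hσ : IsPathSet I σ) {c : IndexN I σ → K} (hc : IsGood c)
    (f : TopPath e → K) : evalFun c (∑ q ∈ σ, f q • q.elt I) = fun q : σ => f q := by
  classical
  change evalLin hc _ = _
  rw [map_sum, ← Finset.sum_coe_sort σ]
  have (q : σ) : evalLin hc (f q • q.1.elt I) = Pi.single q (f q) := by
    rw [map_smul]
    change f q • evalFun c _ = _
    rw [hc.evalFun_elt_of_mem hσ q.2, ← Pi.single_smul, smul_eq_mul, mul_one]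
  simp only [this]
  exact Finset.univ_sum_single _

/-- The evaluation map sends a critical path to its prescribed coefficient vector and the paths in
`σ` to unit vectors, so each relation lies in the kernel. -/
theorem isCoeff_kerSubmodule [Fintype ι] (hσ : IsPathSet I σ) {c : IndexN I σ → K}
    (hc : IsGood c) : IsCoeff (kerSubmodule hc) c := by
  rw [isCoeff_iff]
  intro y
  rw [sum_sigmaSet, sum_red_mkQ, ← mkQ_elt, ← sub_eq_zero, ← map_sub, Submodule.mkQ_apply,
    Submodule.Quotient.mk_eq_zero]
  change evalLin hc _ = 0
  rw [map_sub, sub_eq_zero]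
  exact (hc.evalFun_elt _ y.2.2.2).trans (hc.evalFun_sum hσ _).symm

/-- The relations already give the radical layers; independence modulo the kernel is visible on the
unit vectors. -/
theorem isDistinguished_kerSubmodule [Fintype ι] (hσ : IsPathSet I σ) {c : IndexN I σ → K}
    (hc : IsGood c) : IsDistinguished I σ (kerSubmodule hc) := by
  classical
  refine (isCoeff_kerSubmodule hσ hc).isDistinguished hσ (linearIndepOn_finset_iff.2 ?_)
  intro f hf q hq
  rw [sum_red_mkQ, Submodule.mkQ_apply, Submodule.Quotient.mk_eq_zero] at hf
  have h : evalFun c (∑ q ∈ σ, f q • q.elt I) = 0 := hf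
  rw [hc.evalFun_sum hσ] at h
  exact congrFun h ⟨q, hq⟩

theorem IsDistinguished.linearIndepOn (hσ : IsPathSet I σ)
    {C : Submodule (PathAlgebra K V ⧸ I) (Proj I e)} (h : IsDistinguished I σ C) :
    LinearIndepOn K (fun y : TopPath e => y.act I fun r => C.mkQ (topElt I e r))
      (σ : Set (TopPath e)) :=
  IsSkeletonRel.linearIndepOn hσ h

theorem IsDistinguished.existsUnique_isCoeff (hσ : IsPathSet I σ)
    {C : Submodule (PathAlgebra K V ⧸ I) (Proj I e)} (h : IsDistinguished I σ C) :
    ∃! c : IndexN I σ → K, IsCoeff C c := by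
  obtain ⟨c, hc⟩ := IsSkeletonRel.exists_isRelated h
  refine ⟨c, (isCoeff_iff C c).2 hc, fun c' hc' => ?_⟩
  exact IsRelated.unique (h.linearIndepOn hσ) ((isCoeff_iff C c').1 hc') hc

theorem IsDistinguished.isGood (hσ : IsPathSet I σ)
    {C : Submodule (PathAlgebra K V ⧸ I) (Proj I e)} (h : IsDistinguished I σ C)
    {c : IndexN I σ → K} (hc : IsCoeff C c) : IsGood c :=
  ((isCoeff_iff C c).1 hc).isGood hσ (h.linearIndepOn hσ)

theorem isCoeff_submoduleU (c : IndexN I σ → K) : IsCoeff (submoduleU c) c := by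
  intro y
  have h : (submoduleU c).mkQ (critElt c y) = 0 := by
    rw [Submodule.mkQ_apply, Submodule.Quotient.mk_eq_zero]
    exact Submodule.subset_span ⟨y, rfl⟩
  change ((submoduleU c).mkQ.restrictScalars K) _ = 0 at h
  rw [critElt, map_sub, map_sum, sub_eq_zero] at h
  simp only [map_smul] at h
  exact h

theorem IsCoeff.submoduleU_le {C : Submodule (PathAlgebra K V ⧸ I) (Proj I e)}
    {c : IndexN I σ → K} (h : IsCoeff C c) : submoduleU c ≤ C := by
  refine Submodule.span_le.2 ?_
  rintro _ ⟨y, rfl⟩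
  have h' : C.mkQ.restrictScalars K (critElt c y) = 0 := by
    rw [critElt, map_sub, map_sum, sub_eq_zero]
    simp only [map_smul]
    exact h y
  rw [LinearMap.restrictScalars_apply, Submodule.mkQ_apply, Submodule.Quotient.mk_eq_zero] at h'
  exact h'

/-- A submodule with skeleton `σ` is determined by its coefficients. -/
theorem IsCoeff.eq_submoduleU [Finite ι] (hσ : IsPathSet I σ)
    {C : Submodule (PathAlgebra K V ⧸ I) (Proj I e)} (hC : IsDistinguished I σ C)
    {c : IndexN I σ → K} (h : IsCoeff C c) : C = submoduleU c := by
  refine le_antisymm (fun x hx => ?_) h.submoduleU_le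
  -- The relations alone make `σ` span the quotient by `U(c)`, so `x` is a combination of `σ` modulo
  -- `U(c)`. That combination lies in `C`, where independence forces its coefficients to vanish.
  have hspan := (isCoeff_submoduleU c).layerSpan_zero hσ
  have hx' : (submoduleU c).mkQ x ∈
      layerSpan σ I (fun r => (submoduleU c).mkQ (topElt I e r)) 0 := by rw [hspan]; trivial
  have hset : {y : TopPath e | y ∈ σ ∧ 0 ≤ y.length} = σ := by ext; simp
  rw [layerSpan, hset, Submodule.mem_span_image_finset_iff_exists_fun'] at hx'
  obtain ⟨f, hf⟩ := hx'
  rw [sum_red_mkQ] at hf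
  have h₁ : x - ∑ q ∈ σ, f q • q.elt I ∈ submoduleU c := by
    rw [← Submodule.Quotient.mk_eq_zero, Submodule.Quotient.mk_sub, sub_eq_zero]
    exact hf.symm
  have h₂ : ∑ q ∈ σ, f q • q.elt I ∈ C := by
    have := C.sub_mem hx (h.submoduleU_le h₁)
    rwa [sub_sub_cancel] at this
  have h₃ : ∀ q ∈ σ, f q = 0 := by
    refine linearIndepOn_finset_iff.1 (hC.linearIndepOn hσ) f ?_
    rw [sum_red_mkQ, Submodule.mkQ_apply, Submodule.Quotient.mk_eq_zero]
    exact h₂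
  rwa [Finset.sum_eq_zero fun q hq => by rw [h₃ q hq, zero_smul], sub_zero] at h₁

end

end BoundQuiver

/-! ### Linear algebra of Plücker coordinates -/

namespace QP

section

variable {K : Type u} [Field K] {E : Type*} [AddCommGroup E] [Module K E] {k : ℕ} {τ : Type*}

/-- The alternating form `w ↦ det (w, v)`, for a basis of `E` and a family `v` of vectors. -/
noncomputable def volForm [Fintype τ] [DecidableEq τ] (B : Module.Basis (Fin k ⊕ τ) K E)
    (v : τ → E) : E [⋀^Fin k]→ₗ[K] K where
  toFun w := B.det (Sum.elim w v)
  map_update_add' w i x y := by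
    rw [← Sum.update_elim_inl, ← Sum.update_elim_inl, ← Sum.update_elim_inl]
    convert B.det.map_update_add (Sum.elim w v) (Sum.inl i) x y
  map_update_smul' w i a x := by
    rw [← Sum.update_elim_inl, ← Sum.update_elim_inl]
    convert B.det.map_update_smul (Sum.elim w v) (Sum.inl i) a x
  map_eq_zero_of_eq' w i j h hij :=
    B.det.map_eq_zero_of_eq (Sum.elim w v) (i := Sum.inl i) (j := Sum.inl j) h (by simpa using hij)

theorem volForm_apply [Fintype τ] [DecidableEq τ] (B : Module.Basis (Fin k ⊕ τ) K E)
    (v : τ → E) (w : Fin k → E) : volForm B v w = B.det (Sum.elim w v) := rfl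

theorem volForm_ne_zero [Fintype τ] [DecidableEq τ] (B : Module.Basis (Fin k ⊕ τ) K E)
    {v : τ → E} {w : Fin k → E} (h : LinearIndependent K (Sum.elim w v)) :
    volForm B v w ≠ 0 := by
  rw [volForm_apply]
  have := B.finiteDimensional_of_finite
  have hs := h.span_eq_top_of_card_eq_finrank' (Module.finrank_eq_card_basis B).symm
  exact ((Module.Basis.is_basis_iff_det B).1 ⟨h, hs⟩).ne_zero

/-- Cramer's rule. -/
theorem volForm_update [Fintype τ] [DecidableEq τ] (B : Module.Basis (Fin k ⊕ τ) K E)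
    {v : τ → E} {w : Fin k → E} {x : E} {a : τ → K}
    (h : x - ∑ q, a q • v q ∈ Submodule.span K (Set.range w)) (q : τ) :
    volForm B (Function.update v q x) w = volForm B v w * a q := by
  -- The determinant as a linear function of the vector in slot `q`: it kills the span of `w` and
  -- every other `v q'`, so only the coefficient of `v q` survives.
  let L : E →ₗ[K] K := B.det.toMultilinearMap.toLinearMap (Sum.elim w v) (Sum.inr q)
  have hL (y : E) : L y = volForm B (Function.update v q y) w := by
    rw [volForm_apply, ← Sum.update_elim_inr]
    rfl
  have hw : Submodule.span K (Set.range w) ≤ LinearMap.ker L := by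
    refine Submodule.span_le.2 ?_
    rintro _ ⟨j, rfl⟩
    exact B.det.map_update_self (Sum.elim w v) (i := Sum.inr q) (j := Sum.inl j) (by simp)
  have hv (q' : τ) (hq : q' ≠ q) : L (v q') = 0 :=
    B.det.map_update_self (Sum.elim w v) (i := Sum.inr q) (j := Sum.inr q')
      (by simpa using hq.symm)
  have h0 : L (x - ∑ q, a q • v q) = 0 := hw h
  rw [map_sub, sub_eq_zero, map_sum, Finset.sum_eq_single q] at h0
  · rw [← hL, h0, map_smul, hL, Function.update_eq_self, smul_eq_mul, mul_comm]
  · intro q' _ hq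
    rw [map_smul, hv q' hq, smul_zero]
  · exact fun h => absurd (Finset.mem_univ _) h

/-- Two bases of a subspace have proportional Plücker coordinates. -/
theorem exists_map_basis_eq {W : Submodule K E} (b : Module.Basis (Fin k) K W) {w : Fin k → E}
    (hw : ∀ j, w j ∈ W) (hli : LinearIndependent K w) :
    ∃ a : K, a ≠ 0 ∧ ∀ ω : E [⋀^Fin k]→ₗ[K] K, ω w = a * ω fun j => (b j : E) := by
  have := b.finiteDimensional_of_finite
  let w' : Fin k → W := fun j => ⟨w j, hw j⟩
  have hli' : LinearIndependent K w' := LinearIndependent.of_comp W.subtype hli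
  have hs := hli'.span_eq_top_of_card_eq_finrank' (Module.finrank_eq_card_basis b).symm
  refine ⟨b.det w', ((Module.Basis.is_basis_iff_det b).1 ⟨hli', hs⟩).ne_zero, fun ω => ?_⟩
  -- Alternating forms of top degree on `W` are multiples of the determinant, so the change-of-basis
  -- determinant is a scalar valid for all `ω`.
  have := congrArg (fun f => f w') (AlternatingMap.eq_smul_basis_det b (ω.compLinearMap W.subtype))
  simp only [AlternatingMap.smul_apply, smul_eq_mul] at this
  rw [mul_comm]
  exact this

theorem alternating_mem_polyFun {N κ : Type*} [Fintype κ] (ω : E [⋀^Fin k]→ₗ[K] K)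
    (b : κ → E) {g : Fin k → κ → (N → K) → K} (hg : ∀ j i, g j i ∈ polyFun K K N) :
    (fun c => ω fun j => ∑ i, g j i c • b i) ∈ polyFun K K N := by
  classical
  have h (c : N → K) : (ω fun j => ∑ i, g j i c • b i) =
      ∑ r : Fin k → κ, (∏ j, g j (r j) c) * ω fun j => b (r j) := by
    change ω.toMultilinearMap _ = _
    rw [MultilinearMap.map_sum]
    refine Finset.sum_congr rfl fun r _ => ?_
    rw [MultilinearMap.map_smul_univ]
    rfl
  simp only [h]
  exact sum_mem_polyFun _ fun r _ =>
    mul_mem_polyFun (prod_mem_polyFun _ fun j _ => hg j (r j)) (const_mem_polyFun _)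

end

end QP

/-! ### Plücker coordinates and coefficient families determine each other by forms. -/

namespace BoundQuiver

section

variable {K : Type u} [Field K] {V : Type v} [Quiver.{w + 1} V] [Fintype V]
variable {ι : Type z} {e : ι → V}
variable {I : Ideal (PathAlgebra K V)} [I.IsTwoSided] {σ : Finset (TopPath e)}
variable [IsAdmissible I]

open QP Matrix

/-- The representatives in `evalFun` do not depend on `c`, so the formula is polynomial on all of
`𝔸^N`, even though it is linear in `x` only when `c` is good. -/
theorem evalFun_mem_polyFun [Fintype ι] (x : Proj I e) (q : σ) :
    (fun c : IndexN I σ → K => evalFun c x q) ∈ polyFun K K (IndexN I σ) := by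
  simp only [evalFun, Finset.sum_apply, Matrix.mulVec, dotProduct]
  exact sum_mem_polyFun _ fun r _ => sum_mem_polyFun _ fun s _ =>
    mul_mem_polyFun (rep_mem_polyFun _ (fun p => ⟨_, rfl⟩) _ _) (red_mem_polyFun _ _)

/-- If `σ` is a skeleton of `Q/C`, the elements that belong to the paths in `σ` complement a basis
of `C` to a linearly independent family. -/
theorem IsDistinguished.linearIndependent_sumElim (hσ : IsPathSet I σ)
    {C : Submodule (PathAlgebra K V ⧸ I) (Proj I e)} (h : IsDistinguished I σ C)
    {κ : Type*} {w : κ → C.restrictScalars K} (hw : LinearIndependent K w) :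
    LinearIndependent K (Sum.elim (fun j => (w j : Proj I e)) fun q : σ => q.1.elt I) := by
  refine hw.sumElim_of_quotient _ ?_
  rw [Fintype.linearIndependent_iff]
  intro f hf
  have hf' : ∑ q, f q • q.1.elt I ∈ C.restrictScalars K := by
    rw [← Submodule.Quotient.mk_eq_zero, ← Submodule.mkQ_apply, map_sum]
    simp only [map_smul]
    exact hf
  refine Fintype.linearIndependent_iff.1 (h.linearIndepOn hσ) f ?_
  have h0 : C.mkQ.restrictScalars K (∑ q, f q • q.1.elt I) = 0 :=
    (Submodule.Quotient.mk_eq_zero C).2 hf'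
  rw [map_sum] at h0
  rw [← h0]
  refine Finset.sum_congr rfl fun q _ => ?_
  rw [map_smul]
  exact congrArg _ (mkQ_elt C q.1).symm

variable [∀ a b : V, Finite (a ⟶ b)]

theorem IsDistinguished.finrank_quotient [Finite ι] (hσ : IsPathSet I σ)
    {C : Submodule (PathAlgebra K V ⧸ I) (Proj I e)} (h : IsDistinguished I σ C) :
    Module.finrank K (Proj I e ⧸ C) = σ.card := by
  obtain ⟨c, hc, -⟩ := h.existsUnique_isCoeff hσ
  have h₁ := hc.layerSpan_zero hσ
  have hset : {y : TopPath e | y ∈ σ ∧ 0 ≤ y.length} = σ := by ext; simp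
  rw [layerSpan, hset, ← Subtype.range_coe (s := (σ : Set (TopPath e))), ← Set.range_comp] at h₁
  have b := Module.Basis.mk (h.linearIndepOn hσ) h₁.ge
  rw [Module.finrank_eq_card_basis b]
  simp

theorem IsDistinguished.finrank_add [Finite ι] (hσ : IsPathSet I σ)
    {C : Submodule (PathAlgebra K V ⧸ I) (Proj I e)} (h : IsDistinguished I σ C) :
    Module.finrank K (C.restrictScalars K) + σ.card = Module.finrank K (Proj I e) := by
  rw [← h.finrank_quotient hσ, add_comm]
  exact Submodule.finrank_quotient_add_finrank (C.restrictScalars K)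

theorem IsDistinguished.dimVec_eq [Finite ι] (hσ : IsPathSet I σ)
    {C : Submodule (PathAlgebra K V ⧸ I) (Proj I e)} (h : IsDistinguished I σ C) (i : V) :
    dimVec I (Proj I e ⧸ C) i = {y : TopPath e | y ∈ σ ∧ y.tgt = i}.ncard := by
  classical
  set x : ι → Proj I e ⧸ C := fun r => C.mkQ (topElt I e r) with hx
  obtain ⟨c, hc, -⟩ := h.existsUnique_isCoeff hσ
  have h₁ := hc.layerSpan_zero hσ
  have hset : {y : TopPath e | y ∈ σ ∧ 0 ≤ y.length} = σ := by ext; simp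
  rw [layerSpan, hset] at h₁
  set s : Set (TopPath e) := {y | y ∈ σ ∧ y.tgt = i} with hs
  have hr : LinearMap.range (Algebra.lsmul K K (Proj I e ⧸ C) (vtx I i)) =
      Submodule.span K (Set.range fun y : s => y.1.act I x) := by
    rw [LinearMap.range_eq_map, ← h₁, Submodule.map_span]
    apply le_antisymm
    · refine Submodule.span_le.2 ?_
      rintro _ ⟨_, ⟨y, hy, rfl⟩, rfl⟩
      change vtx I i • y.act I x ∈ Submodule.span K _
      by_cases hi : i = y.tgt
      · rw [hi, vtx_smul_act]
        exact Submodule.subset_span ⟨⟨y, hy, hi.symm⟩, rfl⟩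
      · rw [vtx, pathClass_smul_act_of_ne (by exact hi)]
        exact Submodule.zero_mem _
    · refine Submodule.span_le.2 ?_
      rintro _ ⟨⟨y, hy, rfl⟩, rfl⟩
      exact Submodule.subset_span ⟨_, ⟨y, hy, rfl⟩, vtx_smul_act y x⟩
  have hli : LinearIndependent K fun y : s => y.1.act I x :=
    (h.linearIndepOn hσ).mono fun y hy => hy.1
  have hfin : s.Finite := (Finset.finite_toSet σ).subset fun y hy => hy.1
  have := hfin.fintype
  rw [dimVec, hr, finrank_span_eq_card hli, ← Nat.card_eq_fintype_card, Nat.card_coe_set_eq]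

section Grass

variable [Fintype ι] {k : ℕ} {S : Set (Submodule (PathAlgebra K V ⧸ I) (Proj I e))}

/-- By Cramer's rule the coefficient at `(u ẑ_r, q ẑ_s)` is a quotient of two Plücker coordinates of
`C`. The denominator is the determinant of a basis of `C` together with `σ`; in the numerator `u
z_r` replaces `q z_s`. The denominator never vanishes because `σ` complements `C`. -/
theorem formMap_coeff (hσ : IsPathSet I σ)
    (hS : ∀ C ∈ S, Module.finrank K (C.restrictScalars K) = k)
    (hS' : ∀ C, C ∈ S ↔ IsDistinguished I σ C)
    {Z : Set (IndexN I σ → K)} (f : S → Z) (hf : ∀ C, IsCoeff C.1 (f C).1) :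
    FormMap (submoduleCoords I k S hS) (affineSubset Z) f := by
  classical
  rcases isEmpty_or_nonempty S with hE | ⟨⟨C₀⟩⟩
  · exact FormMap.of_isEmpty _ _ _
  have hli (C : S) := ((hS' C.1).1 C.2).linearIndependent_sumElim hσ
    (Module.finBasisOfFinrankEq K (C.1.restrictScalars K) (hS C.1 C.2)).linearIndependent
  have hcard : Fintype.card (Fin k ⊕ σ) = Module.finrank K (Proj I e) := by
    rw [← ((hS' C₀.1).1 C₀.2).finrank_add hσ, hS C₀.1 C₀.2]
    simp
  -- A reference basis taken from one submodule `C₀`; it only normalizes the determinant and is used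
  -- for all `C`.
  let B : Module.Basis (Fin k ⊕ σ) K (Proj I e) :=
    basisOfLinearIndependentOfCardEqFinrank' _ (hli C₀) hcard
  let v : σ → Proj I e := fun q => q.1.elt I
  refine ⟨0, 1, fun a => a.elim, fun ν => MvPolynomial.X (.inl (volForm B (Function.update v
      ⟨ν.2.1, (mem_sigmaSet.1 ν.2.2).1⟩ (ν.1.1.elt I)))), MvPolynomial.X (.inl (volForm B v)),
    fun _ => 1, fun a => a.elim, fun ν => MvPolynomial.isWeightedHomogeneous_X K _ _,
    MvPolynomial.isWeightedHomogeneous_X K _ _, fun _ => one_ne_zero, fun C => ?_,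
    fun C a => a.elim, fun C ν => ?_⟩
  · rw [Coords.eval_X_inl]
    exact volForm_ne_zero B (hli C)
  · rw [Coords.eval_X_inl, Coords.eval_X_inl]
    have hrel : ν.1.1.elt I - ∑ q : σ, red (f C).1 ν.1.1 q • v q ∈ C.1 := by
      have h₁ := (isCoeff_iff _ _).1 (hf C) ν.1
      rw [sum_sigmaSet, sum_red_mkQ, ← mkQ_elt, ← sub_eq_zero, ← map_sub, Submodule.mkQ_apply,
        Submodule.Quotient.mk_eq_zero, ← Finset.sum_coe_sort σ] at h₁
      exact h₁
    have := volForm_update B (v := v) (x := ν.1.1.elt I) (a := fun q => red (f C).1 ν.1.1 q)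
      (w := fun j => (Module.finBasisOfFinrankEq K (C.1.restrictScalars K) (hS C.1 C.2) j :
        Proj I e)) (by
        have hb := congrArg (Submodule.map (C.1.restrictScalars K).subtype)
          (Module.finBasisOfFinrankEq K (C.1.restrictScalars K) (hS C.1 C.2)).span_eq
        rw [Submodule.map_span, Submodule.map_top, Submodule.range_subtype, ← Set.range_comp] at hb
        exact hb.ge hrel) ⟨ν.2.1, (mem_sigmaSet.1 ν.2.2).1⟩
    refine this.trans ?_
    congr 1
    exact red_crit _ ν.1 ν.2

/-- The submodule is the kernel of an evaluation map that is the coordinate map on the span of `σ`.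
Projecting a basis of one fixed submodule to this kernel along `σ` gives a basis varying
polynomially with `c`, and alternating forms of it are polynomials. -/
theorem formMap_submoduleU (hσ : IsPathSet I σ)
    (hS : ∀ C ∈ S, Module.finrank K (C.restrictScalars K) = k)
    (hS' : ∀ C, C ∈ S ↔ IsDistinguished I σ C)
    {Z : Set (IndexN I σ → K)} (f : Z → S) (hf : ∀ c, IsCoeff (f c).1 c.1) :
    FormMap (affineSubset Z) (submoduleCoords I k S hS) f := by
  classical
  rcases isEmpty_or_nonempty Z with hE | ⟨⟨c₀⟩⟩
  · exact FormMap.of_isEmpty _ _ _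
  let C₀ := f c₀
  have hgood (c : Z) : IsGood c.1 := ((hS' _).1 (f c).2).isGood hσ (hf c)
  have hker (c : Z) (x : Proj I e) : x ∈ (f c).1 ↔ evalFun c.1 x = 0 := by
    rw [(hf c).eq_submoduleU hσ ((hS' _).1 (f c).2),
      ← (isCoeff_kerSubmodule hσ (hgood c)).eq_submoduleU hσ
        (isDistinguished_kerSubmodule hσ (hgood c))]
    rfl
  let w₀ : Fin k → C₀.1.restrictScalars K :=
    Module.finBasisOfFinrankEq K (C₀.1.restrictScalars K) (hS C₀.1 C₀.2)
  have hli := ((hS' C₀.1).1 C₀.2).linearIndependent_sumElim hσ (w := w₀)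
    (Module.finBasisOfFinrankEq K (C₀.1.restrictScalars K) (hS C₀.1 C₀.2)).linearIndependent
  let w (c : IndexN I σ → K) (j : Fin k) : Proj I e :=
    (w₀ j : Proj I e) - ∑ q : σ, evalFun c (w₀ j : Proj I e) q • q.1.elt I
  have hw (c : Z) (j : Fin k) : w c.1 j ∈ (f c).1.restrictScalars K := by
    change w c.1 j ∈ (f c).1
    rw [hker]
    change evalLin (hgood c) _ = 0
    have h₁ := (hgood c).evalFun_sum hσ
      fun y => if h : y ∈ σ then evalFun c.1 (w₀ j : Proj I e) ⟨y, h⟩ else 0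
    rw [← Finset.sum_coe_sort σ] at h₁
    simp only [Finset.coe_mem, dif_pos] at h₁
    rw [map_sub, sub_eq_zero]
    exact h₁.symm
  have hwli (c : Z) : LinearIndependent K (w c.1) := by
    rw [Fintype.linearIndependent_iff] at hli ⊢
    intro a ha j
    -- A relation among the projected vectors is a relation among the `w₀ j` and the paths in `σ`;
    -- the corrections supply its coefficients on `σ`.
    refine hli (Sum.elim a fun q => - ∑ j, a j * evalFun c.1 (w₀ j : Proj I e) q) ?_ (.inl j)
    rw [Fintype.sum_sum_type]
    simp only [Sum.elim_inl, Sum.elim_inr, neg_smul, Finset.sum_neg_distrib, Finset.sum_smul]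
    rw [Finset.sum_comm, ← sub_eq_add_neg, ← Finset.sum_sub_distrib, ← ha]
    refine Finset.sum_congr rfl fun j _ => ?_
    rw [smul_sub, Finset.smul_sum]
    simp only [mul_smul]
  choose l hl hl' using fun c : Z => exists_map_basis_eq
    (Module.finBasisOfFinrankEq K ((f c).1.restrictScalars K) (hS (f c).1 (f c).2)) (hw c) (hwli c)
  have hpoly (ω : Proj I e [⋀^Fin k]→ₗ[K] K) :
      (fun c => ω (w c)) ∈ polyFun K K (IndexN I σ) := by
    have h₁ : (fun c => ω (w c)) = fun c => ω fun j => ∑ i : Fin k ⊕ σ,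
        (Sum.elim (fun j' => fun _ => if j' = j then 1 else 0)
          (fun q c => -1 * evalFun c (w₀ j : Proj I e) q) i : (IndexN I σ → K) → K) c •
          (Sum.elim (fun j => (w₀ j : Proj I e)) (fun q : σ => q.1.elt I) i : Proj I e) := by
      funext c
      congr 1
      funext j
      rw [Fintype.sum_sum_type]
      simp [w, sub_eq_add_neg]
    rw [h₁]
    refine alternating_mem_polyFun ω _ (g := fun j i => Sum.elim
      (fun j' => fun _ => if j' = j then 1 else 0)
      (fun q c => -1 * evalFun c (w₀ j : Proj I e) q) i) fun j i => ?_
    rcases i with j' | q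
    · simp only [Sum.elim_inl]
      split_ifs
      · exact one_mem_polyFun
      · exact zero_mem_polyFun
    · exact mul_mem_polyFun (const_mem_polyFun (-1 : K)) (evalFun_mem_polyFun _ q)
  choose P hP using fun ω => mem_polyFun.1 (hpoly ω)
  refine ⟨0, 0, fun ω => MvPolynomial.rename Sum.inr (P ω), fun b => b.elim, 1, l,
    fun ω => isForm_rename_inr _, fun b => b.elim, isForm_one, hl, fun c => ?_, fun c ω => ?_,
    fun c b => b.elim⟩
  · rw [Coords.eval_one]
    exact one_ne_zero
  · rw [Coords.eval_rename_inr]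
    exact (hP ω c.1).trans (hl' c ω)

/-- The set of the submodules `C` such that `σ` is a distinguished skeleton of `Q/C` is isomorphic
to a closed subset of an affine space. -/
theorem exists_coefficientMap (hσ : IsPathSet I σ)
    (hS : ∀ C ∈ S, Module.finrank K (C.restrictScalars K) = k)
    (hS' : ∀ C, C ∈ S ↔ IsDistinguished I σ C) :
    ∃ Ψ : S → IndexN I σ → K,
    (∀ (C : S) (c : IndexN I σ → K), IsCoeff C.1 c ↔ Ψ C = c) ∧
    Set.range Ψ = {c | IsGood c} ∧
    ∃ F : S ≃ Set.range Ψ, (∀ C, (F C).1 = Ψ C) ∧ (∀ c, (F.symm c).1 = submoduleU c.1) ∧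
      FormMap (submoduleCoords I k S hS) (affineSubset (Set.range Ψ)) F ∧
      FormMap (affineSubset (Set.range Ψ)) (submoduleCoords I k S hS) F.symm := by
  choose Ψ hΨ hΨ' using fun C : S => ((hS' C.1).1 C.2).existsUnique_isCoeff hσ
  have heq (C : S) : C.1 = submoduleU (Ψ C) :=
    (hΨ C).eq_submoduleU hσ ((hS' C.1).1 C.2)
  have hinj : Function.Injective Ψ := fun C C' h => Subtype.ext (by rw [heq C, heq C', h])
  obtain ⟨F, hF⟩ : ∃ F : S ≃ Set.range Ψ, ∀ C, (F C).1 = Ψ C :=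
    ⟨Equiv.ofInjective Ψ hinj, fun _ => rfl⟩
  have hsymm (c : Set.range Ψ) : Ψ (F.symm c) = c.1 := by rw [← hF, F.apply_symm_apply]
  refine ⟨Ψ, fun C c => ⟨fun h => (hΨ' C c h).symm, fun h => h ▸ hΨ C⟩, ?_, F, hF, fun c => ?_,
    formMap_coeff hσ hS hS' F fun C => ?_, formMap_submoduleU hσ hS hS' F.symm fun c => ?_⟩
  · ext c
    constructor
    · rintro ⟨C, rfl⟩
      exact ((hS' C.1).1 C.2).isGood hσ (hΨ C)
    · intro hc
      -- Every good family is attained: the kernel of its evaluation map is a preimage.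
      have hmem : kerSubmodule hc ∈ S := (hS' _).2 (isDistinguished_kerSubmodule hσ hc)
      have hcoeff : IsCoeff (⟨kerSubmodule hc, hmem⟩ : S).1 c := isCoeff_kerSubmodule hσ hc
      exact ⟨⟨kerSubmodule hc, hmem⟩, (hΨ' ⟨kerSubmodule hc, hmem⟩ c hcoeff).symm⟩
  · rw [heq, hsymm]
  · rw [hF]
    exact hΨ C
  · rw [← hsymm]
    exact hΨ _

end Grass

end

end BoundQuiver

namespace BoundQuiver

section

variable {K : Type u} [Field K] {V : Type v} [Quiver.{w + 1} V] [Fintype V]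
variable {ι : Type z} {e : ι → V}
variable {I : Ideal (PathAlgebra K V)} [I.IsTwoSided] {σ : Finset (TopPath e)}

open QP Matrix

/-! ### Comparison of the skeleton in `Q̂` with the skeleton in `P̂` -/

theorem mem_smallSkeleton {y : TopPath (smallTop σ)} :
    y ∈ smallSkeleton σ ↔ embedPath σ y ∈ σ := by
  rw [smallSkeleton, Finset.mem_preimage]

theorem top_mem_smallSkeleton (r : Root σ) : TopPath.top (smallTop σ) r ∈ smallSkeleton σ :=
  mem_smallSkeleton.2 r.2

theorem exists_embedPath_eq {y : TopPath e} (hy : TopPath.top e y.root ∈ σ) :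
    ∃ y', embedPath σ y' = y :=
  ⟨⟨⟨y.root, hy⟩, y.tgt, y.path⟩, rfl⟩

theorem isInitial_embedPath {x y : TopPath (smallTop σ)} (h : x.IsInitial y) :
    (embedPath σ x).IsInitial (embedPath σ y) := by
  obtain ⟨t, ht⟩ := h
  exact ⟨t, congrArg (embedPath σ) ht⟩

theorem exists_of_isInitial_embedPath {x : TopPath e} {y : TopPath (smallTop σ)}
    (h : x.IsInitial (embedPath σ y)) : ∃ x', embedPath σ x' = x ∧ x'.IsInitial y := by
  obtain ⟨s, j, p⟩ := y
  obtain ⟨r, i, q⟩ := x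
  obtain ⟨t, ht⟩ := h
  simp only [embedPath, TopPath.mk.injEq, true_and] at ht t
  obtain ⟨rfl, ht⟩ := ht
  obtain rfl := eq_of_heq ht
  exact ⟨⟨s, i, q⟩, rfl, t, rfl⟩

theorem IsPathSet.smallSkeleton (hσ : IsPathSet I σ) : IsPathSet I (smallSkeleton σ) :=
  ⟨fun y hy => hσ.length_le (embedPath σ y) (mem_smallSkeleton.1 hy), fun _ _ hxy hy =>
    mem_smallSkeleton.2 (hσ.initial_mem _ _ (isInitial_embedPath hxy) (mem_smallSkeleton.1 hy))⟩

theorem isCritical_embedPath {y : TopPath (smallTop σ)} :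
    IsCritical I σ (embedPath σ y) ↔ IsCritical I (smallSkeleton σ) y := by
  refine and_congr (not_congr mem_smallSkeleton.symm) (and_congr Iff.rfl
    ⟨fun h x hx hne => ?_, fun h x hx hne => ?_⟩)
  · exact mem_smallSkeleton.2 (h _ (isInitial_embedPath hx)
      fun h' => hne (embedPath_injective σ h'))
  · obtain ⟨x, rfl, hx'⟩ := exists_of_isInitial_embedPath hx
    exact mem_smallSkeleton.1 (h x hx' fun h' => hne (h' ▸ rfl))

theorem mem_sigmaSet_embedPath {y q : TopPath (smallTop σ)} :
    embedPath σ q ∈ sigmaSet σ (embedPath σ y) ↔ q ∈ sigmaSet (smallSkeleton σ) y := by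
  rw [mem_sigmaSet, mem_sigmaSet, mem_smallSkeleton]
  rfl

/-- The embedding of the index set of the small skeleton. -/
def embedIndex (ν : IndexN I (smallSkeleton σ)) : IndexN I σ :=
  ⟨⟨embedPath σ ν.1.1, isCritical_embedPath.2 ν.1.2⟩,
    ⟨embedPath σ ν.2.1, mem_sigmaSet_embedPath.2 ν.2.2⟩⟩

theorem indexN_ext {ν μ : IndexN I σ} (h : ν.1.1 = μ.1.1) (h' : ν.2.1 = μ.2.1) : ν = μ := by
  obtain ⟨⟨y, hy⟩, ⟨q, hq⟩⟩ := ν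
  obtain ⟨⟨y', hy'⟩, ⟨q', hq'⟩⟩ := μ
  simp only at h h'
  subst h h'
  rfl

theorem embedIndex_injective :
    Function.Injective (embedIndex : IndexN I (smallSkeleton σ) → IndexN I σ) := by
  intro ν μ h
  exact indexN_ext (embedPath_injective σ (congrArg (fun ν : IndexN I σ => ν.1.1) h))
    (embedPath_injective σ (congrArg (fun ν : IndexN I σ => ν.2.1) h))

theorem length_pos_of_isCritical {y : TopPath (smallTop σ)}
    (h : IsCritical I (smallSkeleton σ) y) : y.length ≠ 0 := by
  intro h0
  obtain ⟨r, i, p⟩ := y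
  cases p with
  | nil => exact h.1 (top_mem_smallSkeleton r)
  | cons p a => simp [TopPath.length] at h0

/-- A critical path of positive length has its path of length zero in `σ`, so it comes from `P̂`. In
`P̂` no critical path has length zero, since all its top elements belong to `σ`. -/
theorem sumElim_embedIndex_bijective (hσ : IsPathSet I σ) :
    Function.Bijective (Sum.elim embedIndex Subtype.val :
      IndexN I (smallSkeleton σ) ⊕ IndexN₀ I σ → IndexN I σ) := by
  constructor
  · refine embedIndex_injective.sumElim Subtype.val_injective fun ν μ h => ?_
    refine length_pos_of_isCritical ν.1.2 ?_
    rw [← μ.2, ← h]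
    rfl
  · intro ν
    by_cases h : ν.1.1.length = 0
    · exact ⟨.inr ⟨ν, h⟩, rfl⟩
    · obtain ⟨y, hy⟩ := exists_embedPath_eq (σ := σ) (y := ν.1.1)
        (ν.1.2.2.2 _ ν.1.1.top_isInitial fun h' => h (by rw [← h']; rfl))
      obtain ⟨q, hq⟩ := exists_embedPath_eq (σ := σ) (y := ν.2.1)
        (hσ.initial_mem _ _ ν.2.1.top_isInitial (mem_sigmaSet.1 ν.2.2).1)
      have h₁ : IsCritical I σ (embedPath σ y) := by rw [hy]; exact ν.1.2
      have h₂ : embedPath σ q ∈ sigmaSet σ (embedPath σ y) := by rw [hy, hq]; exact ν.2.2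
      exact ⟨.inl ⟨⟨y, isCritical_embedPath.1 h₁⟩, ⟨q, mem_sigmaSet_embedPath.1 h₂⟩⟩,
        indexN_ext hy hq⟩

theorem red_embedPath (c : IndexN I σ → K) (y q : TopPath (smallTop σ)) :
    red (c ∘ embedIndex) y q = red c (embedPath σ y) (embedPath σ q) := by
  by_cases hy : y ∈ smallSkeleton σ
  · classical
    rw [red_self _ hy, red_self _ (mem_smallSkeleton.1 hy)]
    simp only [(embedPath_injective σ).eq_iff]
  · rw [red, red, if_neg hy, if_neg (fun h => hy (mem_smallSkeleton.2 h))]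
    by_cases h : IsCritical I (smallSkeleton σ) y ∧ q ∈ sigmaSet (smallSkeleton σ) y
    · rw [dif_pos h, dif_pos ⟨isCritical_embedPath.2 h.1, mem_sigmaSet_embedPath.2 h.2⟩]
      rfl
    · rw [dif_neg h, dif_neg]
      exact fun h' => h ⟨isCritical_embedPath.1 h'.1, mem_sigmaSet_embedPath.1 h'.2⟩

/-- The small skeleton is the same set of paths. -/
noncomputable def smallSkeletonEquiv (hσ : IsPathSet I σ) : ↥(smallSkeleton σ) ≃ ↥σ :=
  Equiv.ofBijective (fun q => ⟨embedPath σ q.1, mem_smallSkeleton.1 q.2⟩) ⟨fun q q' h =>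
    Subtype.ext (embedPath_injective σ (congrArg Subtype.val h)), fun q => by
      obtain ⟨q', hq'⟩ := exists_embedPath_eq (σ := σ) (y := q.1)
        (hσ.initial_mem _ _ q.1.top_isInitial q.2)
      exact ⟨⟨q', mem_smallSkeleton.2 (hq' ▸ q.2)⟩, Subtype.ext hq'⟩⟩

theorem pathMat_embedIndex (hσ : IsPathSet I σ) (c : IndexN I σ → K) {i j : V}
    (p : Quiver.Path i j) : pathMat (c ∘ embedIndex) p =
      (pathMat c p).submatrix (smallSkeletonEquiv hσ) (smallSkeletonEquiv hσ) := by
  classical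
  induction p with
  | nil =>
    ext q' q
    simp only [pathMat, vtxMat, Matrix.submatrix_apply, Matrix.diagonal_apply,
      EmbeddingLike.apply_eq_iff_eq]
    rfl
  | @cons j k p a ih =>
    rw [pathMat, pathMat, ← Matrix.submatrix_mul_equiv _ _ _ (smallSkeletonEquiv hσ), ih]
    congr 1
    ext q' q
    rw [Matrix.submatrix_apply]
    by_cases hj : j = q.1.tgt
    · subst hj
      rw [arrowMat_apply, red_embedPath]
      exact (arrowMat_apply c (smallSkeletonEquiv hσ q') (smallSkeletonEquiv hσ q) a).symm
    · rw [arrowMat_apply_of_ne _ a q' q hj]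
      exact (arrowMat_apply_of_ne c a _ (smallSkeletonEquiv hσ q) hj).symm

theorem rep_embedIndex (hσ : IsPathSet I σ) (c : IndexN I σ → K) (ρ : PathAlgebra K V) :
    rep (c ∘ embedIndex) ρ =
      (rep c ρ).submatrix (smallSkeletonEquiv hσ) (smallSkeletonEquiv hσ) := by
  induction ρ using PathAlgebra.induction_on with
  | zero => simp
  | add ρ ρ' h h' => rw [map_add, map_add, h, h', Matrix.submatrix_add]; rfl
  | smul_of a p =>
    rw [map_smul, map_smul, rep_of, rep_of, pathMat_embedIndex hσ, Matrix.submatrix_smul]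
    rfl

/-- The matrices of both families agree up to relabelling, because arrow matrices involve only
one-arrow extensions of paths in `σ`. Hence the coordinates in `N₀` are unconstrained. -/
theorem isGood_embedIndex (hσ : IsPathSet I σ) (c : IndexN I σ → K) :
    IsGood (c ∘ embedIndex) ↔ IsGood c := by
  refine forall₂_congr fun ρ _ => ?_
  rw [rep_embedIndex hσ]
  refine ⟨fun h => ?_, fun h => by rw [h]; rfl⟩
  ext q' q
  have := congrFun (congrFun h ((smallSkeletonEquiv hσ).symm q')) ((smallSkeletonEquiv hσ).symm q)
  simpa using this

/-- The affine coordinates split into those that belong to the small skeleton, and those that belong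
to the critical paths of length zero. -/
theorem nonempty_iso_prodAffine (hσ : IsPathSet I σ) {Z : Set (IndexN I σ → K)}
    {Z' : Set (IndexN I (smallSkeleton σ) → K)} (hZ : Z = {c | IsGood c})
    (hZ' : Z' = {c | IsGood c}) :
    Nonempty (Iso (affineSubset Z) ((affineSubset Z').prodAffine (IndexN₀ I σ))) := by
  subst hZ hZ'
  let g := Equiv.ofBijective _ (sumElim_embedIndex_bijective hσ)
  have hg (x : IndexN I (smallSkeleton σ) → K) (x₀ : IndexN₀ I σ → K) :
      (Sum.elim x x₀ ∘ g.symm) ∘ embedIndex = x := by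
    funext ν
    have : g.symm (embedIndex ν) = .inl ν := g.symm_apply_eq.2 rfl
    simp [this]
  have hg₀ (x : IndexN I (smallSkeleton σ) → K) (x₀ : IndexN₀ I σ → K) :
      (fun ν : IndexN₀ I σ => (Sum.elim x x₀ ∘ g.symm) ν.1) = x₀ := by
    funext ν
    have : g.symm ν.1 = .inr ν := g.symm_apply_eq.2 rfl
    simp [this]
  let f : {c : IndexN I σ → K | IsGood c} ≃
      {c : IndexN I (smallSkeleton σ) → K | IsGood c} × (IndexN₀ I σ → K) :=
    { toFun := fun c => (⟨c.1 ∘ embedIndex, (isGood_embedIndex hσ c.1).2 c.2⟩, fun ν => c.1 ν.1)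
      invFun := fun x => ⟨Sum.elim x.1.1 x.2 ∘ g.symm,
        (isGood_embedIndex hσ _).1 (by rw [hg]; exact x.1.2)⟩
      left_inv := fun c => by
        refine Subtype.ext (funext fun ν => ?_)
        obtain ⟨μ, rfl⟩ := g.surjective ν
        simp only [Function.comp_apply, g.symm_apply_apply]
        rcases μ with μ | μ <;> rfl
      right_inv := fun x => Prod.ext (Subtype.ext (hg _ _)) (hg₀ _ _) }
  refine ⟨Iso.ofFormMap f (FormMap.of_reindex g fun x b => ?_)
    (FormMap.of_reindex g.symm fun x b => rfl)⟩
  rcases b with b | b <;> rfl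

theorem card_smallSkeleton (hσ : IsPathSet I σ) : (smallSkeleton σ).card = σ.card := by
  simpa using Fintype.card_congr (smallSkeletonEquiv hσ)

/-! ### Characterizations of the two varieties -/

theorem IsSkeleton.isPathSet {t d : V → ℕ} (h : IsSkeleton I t d σ) : IsPathSet I σ :=
  ⟨h.length_le, h.initial_mem⟩

theorem IsSkeleton.card_eq {t d : V → ℕ} (h : IsSkeleton I t d σ) : ∑ i, d i = σ.card := by
  classical
  rw [Finset.card_eq_sum_card_fiberwise (f := TopPath.tgt) (t := Finset.univ)
    fun _ _ => Finset.mem_coe.2 (Finset.mem_univ _)]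
  refine Finset.sum_congr rfl fun i _ => ?_
  rw [← h.card_tgt i, ← Set.ncard_coe_finset, Finset.coe_filter]

/-- The top elements together with `J Q` span a `K`-subspace that is stable under `Λ`: idempotents
fix or kill the top elements, and positive-length paths land in `J Q`. -/
theorem mem_sup_radPow [IsAdmissible I] [Finite ι] (x : Proj I e) :
    ∃ a : ι →₀ K, x - a.sum (fun r b => b • topElt I e r) ∈ radPow I (Proj I e) 1 := by
  let W : Submodule K (Proj I e) := Submodule.span K (Set.range (topElt I e)) ⊔
    (radPow I (Proj I e) 1).restrictScalars K
  have htop (r : ι) : topElt I e r ∈ W := Submodule.mem_sup_left (Submodule.subset_span ⟨r, rfl⟩)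
  have hrad {j : Proj I e} (hj : j ∈ radPow I (Proj I e) 1) : j ∈ W := Submodule.mem_sup_right hj
  have hvtx (i : V) : W ≤ W.comap (Algebra.lsmul K K (Proj I e) (vtx I i)) := by
    refine sup_le (Submodule.span_le.2 ?_) fun j hj => hrad (Submodule.smul_mem _ _ hj)
    rintro _ ⟨r, rfl⟩
    change vtx I i • topElt I e r ∈ W
    by_cases hr : i = e r
    · rw [hr, vtx_smul_topElt]
      exact htop r
    · rw [← vtx_smul_topElt, ← mul_smul, vtx, vtx, pathClass_mul_of_ne I (by exact hr), zero_smul]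
      exact zero_mem _
  suffices x ∈ W by
    obtain ⟨y, hy, j, hj, rfl⟩ := Submodule.mem_sup.1 this
    obtain ⟨a, rfl⟩ := (Finsupp.mem_span_range_iff_exists_finsupp).1 hy
    exact ⟨a, by rwa [add_sub_cancel_left]⟩
  have hx : x ∈ Submodule.span (PathAlgebra K V ⧸ I) (Set.range (topElt I e)) := by
    rw [span_topElt]; trivial
  induction hx using Submodule.span_induction with
  | mem x hx =>
    obtain ⟨r, rfl⟩ := hx
    exact htop r
  | zero => exact zero_mem _
  | add x y _ _ hx hy => exact add_mem hx hy
  | smul t x _ hx =>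
    have ht : t ∈ pathSpan I 0 := by rw [pathSpan_zero]; trivial
    have h : pathSpan I 0 ≤ W.comap
        ((LinearMap.toSpanSingleton (PathAlgebra K V ⧸ I) _ x).restrictScalars K) := by
      refine Submodule.span_le.2 ?_
      rintro _ ⟨p, -, rfl⟩
      change pathClass I p • x ∈ W
      rcases Nat.eq_zero_or_pos p.path.length with hp | hp
      · rw [AnyPath.eq_nil_of_length hp]
        exact hvtx p.src hx
      · exact hrad (pathClass_smul_mem_radPow I hp x)
    exact h ht

/-- Write `x ∈ C` as a combination of top elements plus an element of `J Q`. That combination maps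
into the radical of `Q/C`, and independence of the top elements there makes it zero. -/
theorem IsDistinguished.le_radPow [IsAdmissible I] [Finite ι]
    {C : Submodule (PathAlgebra K V ⧸ I) (Proj I e)} (h : IsDistinguished I σ C)
    (htop : ∀ r, TopPath.top e r ∈ σ) : C ≤ radPow I (Proj I e) 1 := by
  intro x hx
  obtain ⟨a, ha⟩ := mem_sup_radPow x
  have hmap : (radPow I (Proj I e) 1).map C.mkQ ≤ radPow I (Proj I e ⧸ C) 1 := by
    rw [radPow, Submodule.map_smul'']
    exact Submodule.smul_mono le_rfl le_top
  have h₁ : C.mkQ (x - a.sum fun r b => b • topElt I e r) ∈ radPow I (Proj I e ⧸ C) 1 :=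
    hmap ⟨_, ha, rfl⟩
  have hx0 : C.mkQ x = 0 := by
    rw [Submodule.mkQ_apply, Submodule.Quotient.mk_eq_zero]
    exact hx
  rw [map_sub, hx0, zero_sub, neg_mem_iff, ← Submodule.Quotient.mk_eq_zero] at h₁
  have hli : LinearIndependent K fun r : ι =>
      (radPow I (Proj I e ⧸ C) 1).mkQ (C.mkQ (topElt I e r)) :=
    h.linearIndependent_top.comp (fun r : ι => (⟨r, htop r⟩ : Root σ))
      fun r s h => congrArg Subtype.val h
  have h₂ : ((radPow I (Proj I e ⧸ C) 1).mkQ.restrictScalars K ∘ₗ C.mkQ.restrictScalars K)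
      (a.sum fun r b => b • topElt I e r) = 0 := h₁
  rw [map_finsuppSum] at h₂
  simp only [map_smul] at h₂
  have h₃ : a = 0 := linearIndependent_iff.1 hli a h₂
  rwa [h₃, Finsupp.sum_zero_index, sub_zero] at ha

variable [IsAdmissible I] [∀ a b : V, Finite (a ⟶ b)]

/-- The skeleton condition already forces the dimension and, as all top elements of `P` belong to
it, containment in `J P`. The identity `finrank_add` also shows that the subtraction of natural
numbers is not truncated. -/
theorem mem_smallGrass_iff [Finite ι] {t d : V → ℕ} (hσ : IsSkeleton I t d σ)
    (C : Submodule (PathAlgebra K V ⧸ I) (Proj I (smallTop σ))) :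
    C ∈ SmallGrass I d σ ↔ IsDistinguished I (smallSkeleton σ) C := by
  refine ⟨fun h => h.2.2, fun h => ⟨?_, h.le_radPow top_mem_smallSkeleton, h⟩⟩
  rw [hσ.card_eq, ← card_smallSkeleton hσ.isPathSet, ← h.finrank_add hσ.isPathSet.smallSkeleton,
    Nat.add_sub_cancel]

theorem mem_bigGrass_iff {t d : V → ℕ} {σ : Finset (TopPath (bigTop d))} (hσ : IsSkeleton I t d σ)
    (C : Submodule (PathAlgebra K V ⧸ I) (Proj I (bigTop d))) :
    C ∈ BigGrass I d σ ↔ IsDistinguished I σ C := by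
  refine ⟨fun h => h.2.2, fun h => ⟨?_, ?_, h⟩⟩
  · rw [hσ.card_eq, ← h.finrank_add hσ.isPathSet, Nat.add_sub_cancel]
  · funext i
    rw [h.dimVec_eq hσ.isPathSet, hσ.card_tgt]

end

end BoundQuiver

/-! ### Assembly of the three statements. -/

theorem theorem3p17 {K : Type u} [Field K] [IsAlgClosed K]
    {V : Type v} [Fintype V] [Quiver.{w + 1} V] [∀ a b : V, Finite (a ⟶ b)]
    (I : Ideal (PathAlgebra K V)) [I.IsTwoSided] [IsAdmissible I]
    (t d : V → ℕ) (σ : Finset (TopPath (bigTop d))) (hσ : IsSkeleton I t d σ) :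
    -- comparison with the small variety, and affineness
    (Nonempty (QP.Iso (bigGrass I d σ) ((smallGrass I d σ).prodAffine (IndexN₀ I σ))) ∧
      QP.IsAffineVariety (bigGrass I d σ)) ∧
    -- the coefficient map `Ψ`: existence and uniqueness of the coefficients
    ∃ Ψ : BigGrass I d σ → IndexN I σ → K,
      (∀ (C : BigGrass I d σ) (c : IndexN I σ → K), IsCoeff C.1 c ↔ Ψ C = c) ∧
      -- isomorphism onto a closed subvariety, its inverse, and the commutative diagram
      ((QP.affineSpace K (IndexN I σ)).IsClosed (Set.range Ψ) ∧
        ∃ F : QP.Iso (bigGrass I d σ) (QP.affineSubset (Set.range Ψ)),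
          (∀ C, (F.toEquiv C).1 = Ψ C) ∧
          (∀ c, (F.toEquiv.symm c).1 = submoduleU c.1) ∧
          ∃ (χ : Set.range Ψ → skeletonTypes I σ) (φ : BigGrass I d σ → skeletonTypes I σ),
            (∀ c, (χ c).1 = isoType _ (Proj I (bigTop d) ⧸ submoduleU c.1)) ∧
            (∀ C, (φ C).1 = isoType _ (Proj I (bigTop d) ⧸ C.1)) ∧
            χ = φ ∘ F.toEquiv.symm) ∧
      -- field of definition
      ∀ K₀ : Subfield K,
        (∃ R : Set (PathAlgebra K V), (∀ x ∈ R, ∀ p, x.coeff p ∈ K₀) ∧ Ideal.span R = I) →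
        ∃ S : Finset (MvPolynomial (IndexN I σ) K₀),
          Set.range Ψ = {c | ∀ f ∈ S, MvPolynomial.aeval c f = 0} := by
  classical
  have := Fintype.ofFinite (Root σ)
  have hp := hσ.isPathSet
  obtain ⟨Ψ, hΨ, hr, F, hF, hFs, hf, hf'⟩ := exists_coefficientMap hp
    (S := BigGrass I d σ) (fun _ h => h.1) (mem_bigGrass_iff hσ)
  -- The same parametrization is applied to `P`, so the two varieties are compared through their
  -- coefficient spaces and no direct map between submodules is needed.
  obtain ⟨Ψ', -, hr', F', -, -, hg, hg'⟩ := exists_coefficientMap hp.smallSkeleton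
    (S := SmallGrass I d σ) (fun _ h => h.1) (mem_smallGrass_iff hσ)
  have hclosed : (QP.affineSpace K (IndexN I σ)).IsClosed (Set.range Ψ) := by
    rw [hr]
    exact isClosed_isGood
  let G : QP.Iso (bigGrass I d σ) (QP.affineSubset (Set.range Ψ)) := QP.Iso.ofFormMap F hf hf'
  obtain ⟨T⟩ := nonempty_iso_prodAffine hp hr hr'
  let G' : QP.Iso ((smallGrass I d σ).prodAffine (IndexN₀ I σ))
      ((QP.affineSubset (Set.range Ψ')).prodAffine (IndexN₀ I σ)) :=
    QP.Iso.ofFormMap (F'.prodCongr (Equiv.refl _)) (hg.prodAffine _) (hg'.prodAffine _)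
  -- The residue classes of the distinguished top elements witness the skeleton of the quotient.
  let φ (C : BigGrass I d σ) : skeletonTypes I σ :=
    ⟨isoType _ (Proj I (bigTop d) ⧸ C.1), _, inferInstance, inferInstance, inferInstance,
      inferInstance, rfl, _, C.2.2.2⟩
  refine ⟨⟨⟨(G.trans T).trans G'.symm⟩, QP.isAffineVariety_of_iso hclosed G⟩, Ψ, hΨ,
    ⟨hclosed, G, hF, hFs, φ ∘ G.toEquiv.symm, φ, fun c => ?_, fun C => rfl, rfl⟩, fun K₀ hK => ?_⟩
  · exact congrArg (fun C => isoType (PathAlgebra K V ⧸ I) (Proj I (bigTop d) ⧸ C)) (hFs c)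
  · obtain ⟨R, hR, hRI⟩ := hK
    rw [hr]
    exact exists_finset_isGood hRI fun ρ hρ p => ⟨⟨_, hR ρ hρ p⟩, rfl⟩
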